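/- Let $(\Omega,\mathcal F,\mathbb P)$ be a probability space, $d$ a dimension, $\theta^*\in\mathbb R^d$, and consider the linear stochastic system $$y_{k+1}=\theta^{*T}x_k+w_{k+1},\qquad k\ge 0,$$ with random $x_k\in\mathbb R^d$ and $w_{k+1}\in\mathbb R$. Let $\Phi:\mathbb R\to\mathbb R$ and $l>0$, and assume the following. A1') $\Phi$ is nonnegative and convex on $\mathbb R$, and $\Phi(t)>\Phi(0)$ for all $t\ne0$. The function $\Phi$ has a derivative $\varphi$ at every point; $\varphi$ is continuous on $\mathbb R$ and continuously differentiable on $(-\infty,0)\cup(0,\infty)$. For some $c>0$ and $a>0$, $|\Phi(t)|\le c(|t|^l+1)$ for all $t\in\mathbb R$ and $|\varphi'(t)|\le c(|t|^l+1)$ for all $t\in(-\infty,-a)\cup(a,\infty)$. A2) All $x_k$, $k\ge0$, have the same probability density function $q$ on $\mathbb R^d$, and $q$ is positive on the ball $B_r(0)$ for some $r>0$. Moreover $\mathbb E x_k=0$, $\mathbb E\|x_k\|^{2(l+2)+\epsilon_0}<\infty$ for some $\epsilon_0>0$, and $\{x_k\}_{k\ge0}$ is $\phi$-mixing with coefficients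 $$\phi_k=\sup_n\ \sup\left\{\frac{|\mathbb P(A\cap B)-\mathbb P(A)\mathbb P(B)|}{\mathbb P(A)}:\ A\in\sigma(x_0,\dots,x_n),\ \mathbb P(A)>0,\ B\in\sigma(x_{n+k},x_{n+k+1},\dots)\right\}$$ such that $\phi_k\le\mu\rho^k$ for all $k\ge0$, for some $\mu>0$ and $0<\rho<1$. A3) $\{w_{k+1}\}_{k\ge0}$ is an i.i.d. sequence with a probability density function $f_w$ that is even, and positive and continuous at the origin; $\mathbb E|w_{k+1}|^{2l+\epsilon_0}<\infty$ for some $\epsilon_0>0$; and for each $k\ge0$ the variable $w_{k+1}$ is independent of $(x_0,\dots,x_k,w_1,\dots,w_k)$. Let $M_k=k^{1/(1+2l)}$ for $k\ge 0$ (so $M_0=0$). From an arbitrary initial value $\theta_1$ and $\sigma_1=1$, define recursively for $k\ge1$ $$\bar\theta_{k+1}=\theta_k+\tfrac1k\,x_k\,\varphi\bigl(y_{k+1}-\theta_k^Tx_k\bigr),\qquad \theta_{k+1}=\bar\theta_{k+1}\,\mathbb I_{[\|\bar\theta_{k+1}\|\le M_{\sigma_k}]},\qquad \sigma_{k+1}=\sum_{i=1}^{k}\mathbb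 I_{[\|\bar\theta_{i+1}\|>M_{\sigma_i}]}.$$ Then $\theta_k\to\theta^*$ almost surely as $k\to\infty$. -/

import Mathlib

open MeasureTheory ProbabilityTheory Filter Topology
open scoped ENNReal

noncomputable section

namespace ConvexIdent

/-- The σ-algebra generated by `z 0, …, z n`. -/
@[reducible] def sigmaPast {Ω S : Type*} [MeasurableSpace S] (z : ℕ → Ω → S) (n : ℕ) : MeasurableSpace Ω :=
  ⨆ i : ℕ, ⨆ _ : i ≤ n, MeasurableSpace.comap (z i) inferInstance

/-- The σ-algebra generated by `z n, z (n + 1), …`. -/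
@[reducible] def sigmaFuture {Ω S : Type*} [MeasurableSpace S] (z : ℕ → Ω → S) (n : ℕ) : MeasurableSpace Ω :=
  ⨆ i : ℕ, ⨆ _ : n ≤ i, MeasurableSpace.comap (z i) inferInstance

/-- The `k`-th `φ`-mixing coefficient of the process `z`: the supremum over `n`, over
`A ∈ σ(z 0, …, z n)` with `P A > 0` and over `B ∈ σ(z (n + k), z (n + k + 1), …)` of
`|P (A ∩ B) - P A * P B| / P A`. -/
def phiMixingCoeff {Ω S : Type*} [MeasurableSpace Ω] [MeasurableSpace S]
    (P : Measure Ω) (z : ℕ → Ω → S) (k : ℕ) : ℝ≥0∞ :=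
  ⨆ (n : ℕ) (A : Set Ω) (B : Set Ω) (_ : MeasurableSet[sigmaPast z n] A)
    (_ : 0 < P A) (_ : MeasurableSet[sigmaFuture z (n + k)] B),
    ENNReal.ofReal (|P.real (A ∩ B) - P.real A * P.real B| / P.real A)

/-- The process `z` is `φ`-mixing. -/
def IsPhiMixing {Ω S : Type*} [MeasurableSpace Ω] [MeasurableSpace S]
    (P : Measure Ω) (z : ℕ → Ω → S) : Prop :=
  Tendsto (phiMixingCoeff P z) atTop (𝓝 0)

/-- `p` is a probability density function (with respect to Lebesgue measure) of the random
vector `X`. -/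
def IsPdf {Ω E : Type*} [MeasurableSpace Ω] [MeasureSpace E]
    (P : Measure Ω) (X : Ω → E) (p : E → ℝ) : Prop :=
  Measurable p ∧ (∀ u, 0 ≤ p u) ∧
    P.map X = volume.withDensity (fun u => ENNReal.ofReal (p u))

/-- Assumptions on the loss function `Φ`, with derivative `φ` and growth exponent `l`. -/
structure LossAssumption (Φ φ : ℝ → ℝ) (l : ℝ) : Prop where
  l_pos : 0 < l
  nonneg : ∀ t, 0 ≤ Φ t
  convex : ConvexOn ℝ Set.univ Φ
  strict_min : ∀ t, t ≠ 0 → Φ 0 < Φ t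
  hasDeriv : ∀ t, HasDerivAt Φ (φ t) t
  deriv_continuous : Continuous φ
  deriv_contDiff : ContDiffOn ℝ 1 φ {t : ℝ | t ≠ 0}
  growth : ∃ c : ℝ, 0 < c ∧ (∀ t, |Φ t| ≤ c * (|t| ^ l + 1)) ∧
    ∃ a : ℝ, 0 < a ∧ ∀ t, a < |t| → |deriv φ t| ≤ c * (|t| ^ l + 1)

/-- Assumptions on the regressors `x 0, x 1, …`. -/
structure RegressorAssumption {Ω : Type*} [MeasurableSpace Ω] (P : Measure Ω) {d : ℕ}
    (x : ℕ → Ω → EuclideanSpace ℝ (Fin d)) (l : ℝ) : Prop where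
  measurable : ∀ k, Measurable (x k)
  density : ∃ q : EuclideanSpace ℝ (Fin d) → ℝ,
    (∀ k, IsPdf P (x k) q) ∧ ∃ r : ℝ, 0 < r ∧ ∀ u ∈ Metric.ball 0 r, 0 < q u
  mean_zero : ∀ k, ∫ ω, x k ω ∂P = 0
  mixing : IsPhiMixing P x
  mixing_rate : ∃ μ : ℝ, 0 < μ ∧ ∃ ρ : ℝ, 0 < ρ ∧ ρ < 1 ∧
    ∀ k, phiMixingCoeff P x k ≤ ENNReal.ofReal (μ * ρ ^ k)
  moment : ∃ ε : ℝ, 0 < ε ∧ ∀ k, Integrable (fun ω => ‖x k ω‖ ^ (2 * (l + 2) + ε)) P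

/-- Assumptions on the noise `w 1, w 2, …` (the variable `w 0` plays no role). -/
structure NoiseAssumption {Ω : Type*} [MeasurableSpace Ω] (P : Measure Ω) {d : ℕ}
    (x : ℕ → Ω → EuclideanSpace ℝ (Fin d)) (w : ℕ → Ω → ℝ) (l : ℝ) : Prop where
  measurable : ∀ k, Measurable (w (k + 1))
  indep : iIndepFun (fun k => w (k + 1)) P
  density : ∃ f : ℝ → ℝ, (∀ k, IsPdf P (w (k + 1)) f) ∧
    (∀ s, f (-s) = f s) ∧ 0 < f 0 ∧ ContinuousAt f 0
  /-- `w (k + 1)` is independent of the data `(x 0, …, x k, w 1, …, w k)` up to time `k`. -/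
  indep_past : ∀ k : ℕ, IndepFun (w (k + 1))
    (fun ω => ((fun i : Fin (k + 1) => x i ω), (fun j : Fin k => w (j + 1) ω))) P
  moment : ∃ ε : ℝ, 0 < ε ∧ ∀ k, Integrable (fun ω => |w (k + 1) ω| ^ (2 * l + ε)) P

/-- The truncation bounds `M_k = k ^ (1 / (1 + 2 l))`. -/
def truncBound (l : ℝ) (k : ℕ) : ℝ := (k : ℝ) ^ (1 / (1 + 2 * l))

/-- The candidate `θ_k + (1 / k) x_k φ(y_{k+1} - θ_kᵀ x_k)` for the next estimate. -/
def candidate {d : ℕ} (φ : ℝ → ℝ) (x : ℕ → EuclideanSpace ℝ (Fin d)) (y : ℕ → ℝ)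
    (θ : ℕ → EuclideanSpace ℝ (Fin d)) (k : ℕ) : EuclideanSpace ℝ (Fin d) :=
  θ k + ((1 / (k : ℝ)) * φ (y (k + 1) - inner ℝ (θ k) (x k))) • x k

open Classical in
/-- The sequences `θ 1, θ 2, …` and `σ 1, σ 2, …` are generated from the data `x`, `y` by the
stochastic approximation algorithm with expanding truncations, from an arbitrary initial value
`θ 1` (the values `θ 0` and `σ 0` play no role). -/
structure IsGenerated {d : ℕ} (φ : ℝ → ℝ) (l : ℝ) (x : ℕ → EuclideanSpace ℝ (Fin d))
    (y : ℕ → ℝ) (θ : ℕ → EuclideanSpace ℝ (Fin d)) (σ : ℕ → ℕ) : Prop where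
  sigma_one : σ 1 = 1
  theta_succ : ∀ k, 1 ≤ k → θ (k + 1) =
    if ‖candidate φ x y θ k‖ ≤ truncBound l (σ k) then candidate φ x y θ k else 0
  sigma_succ : ∀ k, 1 ≤ k → σ (k + 1) =
    ∑ i ∈ Finset.Icc 1 k, if truncBound l (σ i) < ‖candidate φ x y θ i‖ then 1 else 0

end ConvexIdent

end

/-! Write `v k = θ k - θ*` and `u k = ⟨v k, x k⟩`, so that the residual is `w (k+1) - u k`. Let `h
u` be the mean of `φ (w - u) - φ w` (`meanDrift`). By convexity `φ` is nondecreasing, and it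
vanishes only at 0; the noise charges both sides of the origin. Hence `u * h u ≤ 0`, with a bound
`-c` on `|u| ≥ a`. The increment `φ (w - u) x` equals `h u • x` plus noise, and the noise consists
of a martingale difference (`w (k+1)` is independent of the past) and the constant `∫ φ` times the
mean-zero mixing regressor. Second-moment bounds, taken along squares, show that its partial sums `S
k` are almost surely `O(k^(7/8))`.

The rest is pathwise. Summation by parts turns the recursion into one for `ζ k = v k - S k / k`, and
`‖ζ k‖²` decreases by `-(2/k) u h(u)` up to an error `k^(-9/8) (1 + ‖x k‖)^(2(l+1))`, which is
almost surely summable (`exists_corrected_sq_le`). So, while the estimates stay bounded, `‖v k‖` has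
a limit `L` and the decrements are summable. If `L > 0`, consider the windows `[N j, (N+1) j)`. For
`N` large, `v` barely moves inside a window, because the averages of `(1 + ‖x k‖)^(l+1)` converge.
Meanwhile the regressors visit a small ball in the direction of `v` with positive frequency, and
each visit costs at least a constant over `(N+1) j`. The loss per window is then bounded below,
against summability (`tendsto_zero_of_bounded_recursion`). Only visit frequencies to finitely many
balls are needed, so the dependence between `v k` and `x k` does no harm.

Truncations stop: after a late reset to 0, the almost monotone quantity `‖ζ‖²` confines the
candidates to a fixed ball, which infinitely many truncations would by then have put inside the
truncation bound (`tendsto_of_expanding_truncations`).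

The initial value may depend on `ω` in any way. But `σ 2 = 0` unless the first step truncates, and
`M_0 = 0`, so the estimate is 0 at time 2 or 3. From there the path is one of countably many
trajectories with deterministic start, and these are adapted to the data. -/

namespace ConvexIdent

/-! ### Pathwise analysis of the recursion and of the truncations -/

section Deterministic

variable {E : Type*} [NormedAddCommGroup E] [InnerProductSpace ℝ E]

/-- One step of the error recursion, after subtracting a correction `s` of the accumulated noise. -/
lemma norm_sq_step_le (v s x r : E) (h κ : ℝ) (hκ : 0 ≤ κ) :
    ‖v - s + (κ * h) • x + r‖ ^ 2 ≤ ‖v - s‖ ^ 2 + 2 * κ * (inner ℝ v x * h)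
      + 2 * κ * ‖s‖ * (|h| * ‖x‖) + 2 * ‖v - s‖ * ‖r‖ + 2 * (κ * (|h| * ‖x‖)) ^ 2
      + 2 * ‖r‖ ^ 2 := by
  have h1 : ‖v - s + ((κ * h) • x + r)‖ ^ 2 =
      ‖v - s‖ ^ 2 + 2 * inner ℝ (v - s) ((κ * h) • x + r) + ‖(κ * h) • x + r‖ ^ 2 :=
    norm_add_sq_real _ _
  rw [← add_assoc] at h1
  rw [h1, inner_add_right, inner_smul_right, inner_sub_left]
  have h2 : ‖(κ * h) • x + r‖ ≤ κ * (|h| * ‖x‖) + ‖r‖ := by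
    refine (norm_add_le _ _).trans ?_
    rw [norm_smul, Real.norm_eq_abs, abs_mul, abs_of_nonneg hκ, mul_assoc]
  have h3 : inner ℝ (v - s) r ≤ ‖v - s‖ * ‖r‖ := real_inner_le_norm _ _
  have h4 : -(inner ℝ s x * h) ≤ ‖s‖ * (|h| * ‖x‖) := by
    have := abs_real_inner_le_norm s x
    calc -(inner ℝ s x * h) ≤ |inner ℝ s x * h| := neg_le_abs _
      _ = |inner ℝ s x| * |h| := abs_mul _ _
      _ ≤ ‖s‖ * ‖x‖ * |h| := by gcongr
      _ = _ := by ring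
  have h5 : ‖(κ * h) • x + r‖ ^ 2 ≤ 2 * (κ * (|h| * ‖x‖)) ^ 2 + 2 * ‖r‖ ^ 2 := by
    have : ‖(κ * h) • x + r‖ ^ 2 ≤ (κ * (|h| * ‖x‖) + ‖r‖) ^ 2 := by gcongr
    nlinarith [sq_nonneg (κ * (|h| * ‖x‖) - ‖r‖)]
  have h6 := mul_le_mul_of_nonneg_left h4 hκ
  nlinarith

/-- Exponent bookkeeping: noise sums of order `k^(7/8)` with step `1/k` give a correction of order
`k^(-1/8)`, which tends to 0, and errors of order `k^(-9/8)`, which are summable. -/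
lemma rpow_bounds {k : ℕ} (hk : 1 ≤ k) :
    (k : ℝ) ^ (7 / 8 : ℝ) / k = (k : ℝ) ^ (-(1 / 8) : ℝ) ∧
    (1 / (k : ℝ)) * (k : ℝ) ^ (-(1 / 8) : ℝ) = (k : ℝ) ^ (-(9 / 8) : ℝ) ∧
    (k : ℝ) ^ (-(1 / 8) : ℝ) ≤ 1 ∧ (1 / (k : ℝ)) ^ 2 ≤ (k : ℝ) ^ (-(9 / 8) : ℝ) ∧
    (k : ℝ) ^ (-(9 / 8) : ℝ) ≤ 1 / k ∧ (k : ℝ) ^ (-(9 / 8) : ℝ) ≤ 1 := by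
  have h1 : (1 : ℝ) ≤ k := by exact_mod_cast hk
  have h0 : (0 : ℝ) < k := by linarith
  refine ⟨?_, ?_, ?_, ?_, ?_, ?_⟩
  · rw [div_eq_mul_inv, ← Real.rpow_neg_one, ← Real.rpow_add h0]; norm_num
  · rw [one_div, ← Real.rpow_neg_one, ← Real.rpow_add h0]; norm_num
  · exact Real.rpow_le_one_of_one_le_of_nonpos h1 (by norm_num)
  · rw [one_div, inv_pow, ← Real.rpow_natCast, ← Real.rpow_neg h0.le]
    exact Real.rpow_le_rpow_of_exponent_le h1 (by norm_num)
  · rw [one_div, ← Real.rpow_neg_one]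
    exact Real.rpow_le_rpow_of_exponent_le h1 (by norm_num)
  · exact Real.rpow_le_one_of_one_le_of_nonpos h1 (by norm_num)

/-- Size of the remainder left by the correction `S k / k`. -/
lemma norm_correction_remainder_le {S : ℕ → E} {C : ℝ} (hC : 0 ≤ C)
    (hS : ∀ k : ℕ, 1 ≤ k → ‖S k‖ ≤ C * (k : ℝ) ^ (7 / 8 : ℝ)) {k : ℕ} (hk : 1 ≤ k) :
    ‖(1 / (k : ℝ) * (1 / ((k + 1 : ℕ) : ℝ))) • S (k + 1)‖ ≤ C * (k : ℝ) ^ (-(9 / 8) : ℝ) := by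
  have h0 : (0 : ℝ) < k := by exact_mod_cast hk
  have h2 := hS (k + 1) (by omega)
  obtain ⟨h3, -, -⟩ := rpow_bounds (k := k + 1) (by omega)
  obtain ⟨-, h4, -⟩ := rpow_bounds (k := k) hk
  rw [norm_smul, Real.norm_of_nonneg (by positivity)]
  calc 1 / (k : ℝ) * (1 / ((k + 1 : ℕ) : ℝ)) * ‖S (k + 1)‖
      ≤ 1 / (k : ℝ) * (1 / ((k + 1 : ℕ) : ℝ)) * (C * ((k + 1 : ℕ) : ℝ) ^ (7 / 8 : ℝ)) := by gcongr
    _ = C * (1 / (k : ℝ) * (((k + 1 : ℕ) : ℝ) ^ (7 / 8 : ℝ) / ((k + 1 : ℕ) : ℝ))) := by ring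
    _ = C * (1 / (k : ℝ) * ((k + 1 : ℕ) : ℝ) ^ (-(1 / 8) : ℝ)) := by rw [h3]
    _ ≤ C * (1 / (k : ℝ) * (k : ℝ) ^ (-(1 / 8) : ℝ)) := by
        gcongr 1
        gcongr 1
        exact Real.rpow_le_rpow_of_nonpos h0 (by push_cast; linarith) (by norm_num)
    _ = _ := by rw [h4]

lemma norm_correction_le {S : ℕ → E} {C : ℝ}
    (hS : ∀ k : ℕ, 1 ≤ k → ‖S k‖ ≤ C * (k : ℝ) ^ (7 / 8 : ℝ)) {k : ℕ} (hk : 1 ≤ k) :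
    ‖(1 / (k : ℝ)) • S k‖ ≤ C * (k : ℝ) ^ (-(1 / 8) : ℝ) := by
  have h0 : (0 : ℝ) < k := by exact_mod_cast hk
  rw [norm_smul, Real.norm_of_nonneg (by positivity), ← (rpow_bounds hk).1]
  calc 1 / (k : ℝ) * ‖S k‖ ≤ 1 / (k : ℝ) * (C * (k : ℝ) ^ (7 / 8 : ℝ)) := by
        gcongr; exact hS k hk
    _ = _ := by ring

/-- Summation by parts: since `1/k - 1/(k+1) = 1/(k(k+1))`, moving `S k / k` into the state replaces
the noise increment by a much smaller remainder. -/
lemma corrected_step_eq (v x : E) (S : ℕ → E) (h : ℝ) {k : ℕ} (hk : 1 ≤ k) :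
    v + (1 / (k : ℝ)) • (h • x + (S (k + 1) - S k)) - (1 / ((k + 1 : ℕ) : ℝ)) • S (k + 1) =
      v - (1 / (k : ℝ)) • S k + (1 / (k : ℝ) * h) • x
        + (1 / (k : ℝ) * (1 / ((k + 1 : ℕ) : ℝ))) • S (k + 1) := by
  have h0 : (0 : ℝ) < k := by exact_mod_cast hk
  have h1 : (1 / (k : ℝ)) = 1 / ((k + 1 : ℕ) : ℝ) + 1 / (k : ℝ) * (1 / ((k + 1 : ℕ) : ℝ)) := by
    push_cast; field_simp
  have h2 : (1 / (k : ℝ)) • S (k + 1) = (1 / ((k + 1 : ℕ) : ℝ)) • S (k + 1)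
      + (1 / (k : ℝ) * (1 / ((k + 1 : ℕ) : ℝ))) • S (k + 1) := by
    rw [← add_smul, ← h1]
  rw [smul_add, smul_sub, h2, smul_smul]
  abel

/-- The corrected squared error decreases up to a summable perturbation. -/
lemma exists_corrected_sq_le {x S : ℕ → E} {h : ℝ → ℝ} {e : ℕ → ℝ} {R C C' : ℝ} (hC : 0 ≤ C)
    (hC' : 0 ≤ C') (hR : 0 ≤ R) (he : ∀ k, 1 ≤ e k)
    (hS : ∀ k : ℕ, 1 ≤ k → ‖S k‖ ≤ C * (k : ℝ) ^ (7 / 8 : ℝ))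
    (hh : ∀ k (v : E), ‖v‖ ≤ R → |h (inner ℝ v (x k))| * ‖x k‖ ≤ C' * e k) :
    ∃ C₁ : ℝ, 0 ≤ C₁ ∧ ∀ k : ℕ, 1 ≤ k → ∀ v : E, ‖v‖ ≤ R →
      ‖v + (1 / (k : ℝ)) • (h (inner ℝ v (x k)) • x k + (S (k + 1) - S k))
        - (1 / ((k + 1 : ℕ) : ℝ)) • S (k + 1)‖ ^ 2 ≤
      ‖v - (1 / (k : ℝ)) • S k‖ ^ 2
        + 2 * (1 / (k : ℝ)) * (inner ℝ v (x k) * h (inner ℝ v (x k)))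
        + C₁ * ((k : ℝ) ^ (-(9 / 8) : ℝ) * e k ^ 2) := by
  -- The four summands come from `t1`, …, `t4` below, the error terms of `norm_sq_step_le`; `1 ≤ e
  -- k` lets all of them be measured by `e k ^ 2`.
  refine ⟨2 * C * C' + 2 * (R + C) * C + 2 * C' ^ 2 + 2 * C ^ 2, by positivity, ?_⟩
  intro k hk v hv
  rw [corrected_step_eq v (x k) S _ hk]
  set u := inner ℝ v (x k)
  set r := (1 / (k : ℝ) * (1 / ((k + 1 : ℕ) : ℝ))) • S (k + 1)
  set s := (1 / (k : ℝ)) • S k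
  set G := (k : ℝ) ^ (-(9 / 8) : ℝ)
  have h0 : (0 : ℝ) < k := by exact_mod_cast hk
  have hG : 0 ≤ G := by positivity
  have hr : ‖r‖ ≤ C * G := norm_correction_remainder_le hC hS hk
  have hs := norm_correction_le hS hk
  obtain ⟨-, b2, b3, b4, b5, b6⟩ := rpow_bounds hk
  have hs1 : ‖s‖ ≤ C := hs.trans (mul_le_of_le_one_right hC b3)
  have hvs : ‖v - s‖ ≤ R + C := (norm_sub_le _ _).trans (by linarith)
  have hx := hh k v hv
  have he1 := he k
  have hee : e k ≤ e k ^ 2 := by nlinarith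
  have he2 : 1 ≤ e k ^ 2 := by nlinarith
  refine (norm_sq_step_le v s (x k) r (h u) (1 / (k : ℝ)) (by positivity)).trans ?_
  have t1 : 2 * (1 / (k : ℝ)) * ‖s‖ * (|h u| * ‖x k‖) ≤ 2 * C * C' * (G * e k ^ 2) := by
    calc 2 * (1 / (k : ℝ)) * ‖s‖ * (|h u| * ‖x k‖)
        ≤ 2 * (1 / (k : ℝ)) * (C * (k : ℝ) ^ (-(1 / 8) : ℝ)) * (C' * e k) := by gcongr
      _ = 2 * C * C' * ((1 / (k : ℝ) * (k : ℝ) ^ (-(1 / 8) : ℝ)) * e k) := by ring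
      _ = 2 * C * C' * (G * e k) := by rw [b2]
      _ ≤ _ := by gcongr
  have t2 : 2 * ‖v - s‖ * ‖r‖ ≤ 2 * (R + C) * C * (G * e k ^ 2) := by
    calc 2 * ‖v - s‖ * ‖r‖ ≤ 2 * (R + C) * (C * G) := by gcongr
      _ = 2 * (R + C) * C * (G * 1) := by ring
      _ ≤ _ := by gcongr
  have t3 : 2 * (1 / (k : ℝ) * (|h u| * ‖x k‖)) ^ 2 ≤ 2 * C' ^ 2 * (G * e k ^ 2) := by
    calc 2 * (1 / (k : ℝ) * (|h u| * ‖x k‖)) ^ 2 ≤ 2 * (1 / (k : ℝ) * (C' * e k)) ^ 2 := by gcongr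
      _ = 2 * C' ^ 2 * ((1 / (k : ℝ)) ^ 2 * e k ^ 2) := by ring
      _ ≤ _ := by gcongr
  have t4 : 2 * ‖r‖ ^ 2 ≤ 2 * C ^ 2 * (G * e k ^ 2) := by
    calc 2 * ‖r‖ ^ 2 ≤ 2 * (C * G) ^ 2 := by gcongr
      _ = 2 * C ^ 2 * (G * G) := by ring
      _ ≤ 2 * C ^ 2 * (G * 1) := by gcongr
      _ ≤ _ := by gcongr
  linarith

/-- A nonnegative sequence that decreases up to summable errors converges, and its decrements are
summable. -/
lemma tendsto_of_almost_decreasing {V D ε : ℕ → ℝ} (hV : ∀ k, 0 ≤ V k) (hD : ∀ k, 0 ≤ D k)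
    (hε : ∀ k, 0 ≤ ε k) (hs : Summable ε) (h : ∀ k, V (k + 1) ≤ V k - D k + ε k) :
    Summable D ∧ ∃ L, Tendsto V atTop (𝓝 L) := by
  have hb : ∀ n, V n + ∑ i ∈ Finset.range n, D i ≤ V 0 + ∑ i ∈ Finset.range n, ε i := by
    intro n
    induction n with
    | zero => simp
    | succ n ih => rw [Finset.sum_range_succ, Finset.sum_range_succ]; linarith [h n]
  constructor
  · refine summable_of_sum_range_le (c := V 0 + ∑' i, ε i) hD fun n => ?_
    linarith [hb n, hV n, hs.sum_le_tsum (Finset.range n) fun i _ => hε i]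
  · set W : ℕ → ℝ := fun n => V n - ∑ i ∈ Finset.range n, ε i
    have hW : Antitone W := antitone_nat_of_succ_le fun n => by
      simp only [W]; rw [Finset.sum_range_succ]; linarith [h n, hD n]
    have hbdd : BddBelow (Set.range W) := by
      refine ⟨-∑' i, ε i, ?_⟩
      rintro _ ⟨n, rfl⟩
      simp only [W]
      linarith [hV n, hs.sum_le_tsum (Finset.range n) fun i _ => hε i]
    have hl := (tendsto_atTop_ciInf hW hbdd).add hs.hasSum.tendsto_sum_nat
    exact ⟨_, hl.congr fun n => by simp [W]⟩

/-- Cesàro convergence passes to averages over the windows `[N j, (N + 1) j)`. -/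
lemma tendsto_window_average {f : ℕ → ℝ} {A : ℝ}
    (hf : Tendsto (fun n : ℕ => (∑ k ∈ Finset.range n, f k) / n) atTop (𝓝 A)) {N : ℕ}
    (hN : 1 ≤ N) :
    Tendsto (fun j : ℕ => (∑ k ∈ Finset.Ico (N * j) ((N + 1) * j), f k) / j) atTop (𝓝 A) := by
  have h1 : Tendsto (fun j : ℕ => N * j) atTop atTop :=
    tendsto_id.const_mul_atTop' (by omega)
  have h2 : Tendsto (fun j : ℕ => (N + 1) * j) atTop atTop :=
    tendsto_id.const_mul_atTop' (by omega)
  -- The sum over the window divided by `j` is `N + 1` times the average at `(N+1) j` minus `N`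
  -- times the average at `N j`.
  have h3 := ((hf.comp h2).const_mul ((N : ℝ) + 1)).sub ((hf.comp h1).const_mul (N : ℝ))
  have h4 : ((N : ℝ) + 1) * A - N * A = A := by ring
  rw [h4] at h3
  refine h3.congr' ?_
  filter_upwards [eventually_ge_atTop 1] with j hj
  have hj0 : (0 : ℝ) < j := by exact_mod_cast hj
  have hN0 : (0 : ℝ) < N := by exact_mod_cast hN
  rw [Finset.sum_Ico_eq_sub _ (Nat.mul_le_mul_right j (Nat.le_succ N))]
  simp only [Function.comp]
  push_cast
  field_simp

lemma tendsto_window_sum_zero {f : ℕ → ℝ} (hf : Summable f) {N : ℕ} (hN : 1 ≤ N) :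
    Tendsto (fun j : ℕ => ∑ k ∈ Finset.Ico (N * j) ((N + 1) * j), f k) atTop (𝓝 0) := by
  have h1 : Tendsto (fun j : ℕ => N * j) atTop atTop :=
    tendsto_id.const_mul_atTop' (by omega)
  have h2 : Tendsto (fun j : ℕ => (N + 1) * j) atTop atTop :=
    tendsto_id.const_mul_atTop' (by omega)
  have h := hf.hasSum.tendsto_sum_nat
  have h3 := (h.comp h2).sub (h.comp h1)
  rw [sub_self] at h3
  refine h3.congr fun j => ?_
  rw [Finset.sum_Ico_eq_sub _ (Nat.mul_le_mul_right j (Nat.le_succ N))]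
  rfl

lemma tendsto_correction_zero {S : ℕ → E} {C : ℝ}
    (hS : ∀ k : ℕ, 1 ≤ k → ‖S k‖ ≤ C * (k : ℝ) ^ (7 / 8 : ℝ)) :
    Tendsto (fun k : ℕ => (1 / (k : ℝ)) • S k) atTop (𝓝 0) := by
  have h1 : Tendsto (fun k : ℕ => C * (k : ℝ) ^ (-(1 / 8) : ℝ)) atTop (𝓝 (C * 0)) :=
    ((tendsto_rpow_neg_atTop (by norm_num : (0 : ℝ) < 1 / 8)).comp
      tendsto_natCast_atTop_atTop).const_mul C
  rw [mul_zero] at h1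
  refine squeeze_zero_norm' ?_ h1
  filter_upwards [eventually_ge_atTop 1] with k hk
  exact norm_correction_le hS hk

lemma norm_sub_le_sum_of_step_le {E : Type*} [NormedAddCommGroup E] {z : ℕ → E} {b : ℕ → ℝ}
    {n m : ℕ} (hnm : n ≤ m)
    (h : ∀ k, n ≤ k → k < m → ‖z (k + 1) - z k‖ ≤ b k) :
    ‖z m - z n‖ ≤ ∑ k ∈ Finset.Ico n m, b k := by
  rw [← Finset.sum_Ico_sub z hnm]
  refine (norm_sum_le _ _).trans (Finset.sum_le_sum fun k hk => ?_)
  rw [Finset.mem_Ico] at hk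
  exact h k hk.1 hk.2

/-- If `v` is close to `v₀` and `y` is close to the vector of length `r / 2` in the direction of
`v₀`, then `inner v y` is bounded below. -/
lemma le_inner_of_near {v v₀ y p : E} {r L : ℝ} (hr : 0 < r) (hL : 0 < L) (hv₀ : L / 2 ≤ ‖v₀‖)
    (hv : ‖v - v₀‖ ≤ L / 16) (hp : ‖(r / 2 / ‖v₀‖) • v₀ - p‖ < r / 8) (hy : ‖y - p‖ < r / 8) :
    L * r / 16 ≤ inner ℝ v y := by
  have h0 : 0 < ‖v₀‖ := by linarith
  set c := (r / 2 / ‖v₀‖) • v₀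
  have hc : ‖c‖ = r / 2 := by
    simp only [c]
    rw [norm_smul, Real.norm_of_nonneg (by positivity)]
    field_simp
  have hyc : ‖y - c‖ ≤ r / 4 := by
    have : y - c = (y - p) - (c - p) := by abel
    rw [this]
    exact (norm_sub_le _ _).trans (by linarith)
  have hyn : ‖y‖ ≤ 3 * r / 4 := by
    have : y = (y - c) + c := by abel
    rw [this]
    exact (norm_add_le _ _).trans (by linarith)
  have e1 : inner ℝ v y = inner ℝ v₀ c + inner ℝ v₀ (y - c) + inner ℝ (v - v₀) y := by
    rw [inner_sub_right, inner_sub_left]; ring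
  have e2 : inner ℝ v₀ c = ‖v₀‖ * (r / 2) := by
    simp only [c]
    rw [inner_smul_right, real_inner_self_eq_norm_sq]
    field_simp
  have e3 : -(‖v₀‖ * (r / 4)) ≤ inner ℝ v₀ (y - c) := by
    have := neg_le_of_abs_le (abs_real_inner_le_norm v₀ (y - c))
    have h2 : ‖v₀‖ * ‖y - c‖ ≤ ‖v₀‖ * (r / 4) := by gcongr
    linarith
  have e4 : -(L / 16 * (3 * r / 4)) ≤ inner ℝ (v - v₀) y := by
    have := neg_le_of_abs_le (abs_real_inner_le_norm (v - v₀) y)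
    have h2 : ‖v - v₀‖ * ‖y‖ ≤ L / 16 * (3 * r / 4) := by gcongr
    linarith
  rw [e1, e2]
  have h5 : L / 2 * (r / 4) ≤ ‖v₀‖ * (r / 4) := by gcongr
  nlinarith [mul_pos hL hr]

/-- The unperturbed part of the recursion contracts in the mean: a bounded trajectory of the
recursion without truncation converges to the origin. -/
theorem tendsto_zero_of_bounded_recursion {v x S : ℕ → E} {h : ℝ → ℝ} {e : ℕ → ℝ}
    {R C C' A r : ℝ} {K : ℕ} (hK : 1 ≤ K) (hC : 0 ≤ C) (hC' : 0 ≤ C') (hR : 0 ≤ R)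
    (he : ∀ k, 1 ≤ e k)
    (hS : ∀ k : ℕ, 1 ≤ k → ‖S k‖ ≤ C * (k : ℝ) ^ (7 / 8 : ℝ))
    (hh : ∀ k (v : E), ‖v‖ ≤ R → |h (inner ℝ v (x k))| * ‖x k‖ ≤ C' * e k)
    (hsum : Summable fun k : ℕ => (k : ℝ) ^ (-(9 / 8) : ℝ) * e k ^ 2)
    (hneg : ∀ u, u * h u ≤ 0) (hexc : ∀ a, 0 < a → ∃ c, 0 < c ∧ ∀ u, a ≤ |u| → u * h u ≤ -c)
    (hvR : ∀ k, K ≤ k → ‖v k‖ ≤ R)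
    (hrec : ∀ k, K ≤ k → v (k + 1) =
      v k + (1 / (k : ℝ)) • (h (inner ℝ (v k) (x k)) • x k + (S (k + 1) - S k)))
    (heA : Tendsto (fun n : ℕ => (∑ k ∈ Finset.range n, e k) / n) atTop (𝓝 A))
    (hr : 0 < r) {F : Set E} (hF : F.Finite)
    (hcover : ∀ y : E, ‖y‖ = r / 2 → ∃ p ∈ F, ‖y - p‖ < r / 8)
    (hfreq : ∀ p ∈ F, ∃ π, 0 < π ∧ Tendsto (fun n : ℕ =>
      (∑ k ∈ Finset.range n, (Metric.ball p (r / 8)).indicator (fun _ => (1 : ℝ)) (x k)) / n)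
      atTop (𝓝 π)) :
    Tendsto v atTop (𝓝 0) := by
  set s : ℕ → E := fun k => (1 / (k : ℝ)) • S k with hs_def
  have hs0 : Tendsto s atTop (𝓝 0) := tendsto_correction_zero hS
  set ζ : ℕ → E := fun k => v k - s k with hζ_def
  set u : ℕ → ℝ := fun k => inner ℝ (v k) (x k) with hu_def
  set D : ℕ → ℝ := fun k => -(2 * (1 / (k : ℝ)) * (u k * h (u k))) with hD_def
  have hD0 : ∀ k, 0 ≤ D k := fun k => by
    simp only [hD_def]
    have : 0 ≤ 2 * (1 / (k : ℝ)) := by positivity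
    nlinarith [hneg (u k)]
  obtain ⟨C₁, hC₁, hstep⟩ := exists_corrected_sq_le hC hC' hR he hS hh
  have hζsq : ∀ k, K ≤ k → ‖ζ (k + 1)‖ ^ 2 ≤
      ‖ζ k‖ ^ 2 - D k + C₁ * ((k : ℝ) ^ (-(9 / 8) : ℝ) * e k ^ 2) := by
    intro k hk
    have := hstep k (hK.trans hk) (v k) (hvR k hk)
    rw [← hrec k hk] at this
    simp only [hζ_def, hs_def, hD_def, hu_def]
    linarith
  obtain ⟨hDsum', L2, hL2⟩ := tendsto_of_almost_decreasing
    (V := fun k => ‖ζ (k + K)‖ ^ 2) (D := fun k => D (k + K))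
    (ε := fun k => C₁ * (((k + K : ℕ) : ℝ) ^ (-(9 / 8) : ℝ) * e (k + K) ^ 2))
    (fun _ => by positivity) (fun _ => hD0 _) (fun _ => by positivity)
    (((summable_nat_add_iff K).2 hsum).mul_left C₁)
    (fun k => by
      have := hζsq (k + K) (by omega)
      rwa [show k + K + 1 = k + 1 + K by ring] at this)
  have hDsum : Summable D := (summable_nat_add_iff K).1 hDsum'
  have hζL : Tendsto (fun k => ‖ζ k‖) atTop (𝓝 (√L2)) := by
    have h1 : Tendsto (fun k => ‖ζ k‖ ^ 2) atTop (𝓝 L2) := (tendsto_add_atTop_iff_nat K).1 hL2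
    have h2 := (Real.continuous_sqrt.tendsto L2).comp h1
    exact h2.congr fun k => Real.sqrt_sq (norm_nonneg _)
  set L := √L2
  have hvL : Tendsto (fun k => ‖v k‖) atTop (𝓝 L) := by
    have h1 : Tendsto (fun k => ‖v k‖ - ‖ζ k‖) atTop (𝓝 0) := by
      refine squeeze_zero_norm (fun k => ?_) (tendsto_zero_iff_norm_tendsto_zero.1 hs0)
      have h2 := abs_norm_sub_norm_le (v k) (ζ k)
      rw [show v k - ζ k = s k by simp [hζ_def]] at h2
      exact h2
    have h2 := h1.add hζL
    rw [zero_add] at h2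
    exact h2.congr fun k => by ring
  rcases (Real.sqrt_nonneg L2).eq_or_lt with hL0 | hLpos
  · rw [tendsto_zero_iff_norm_tendsto_zero]
    rwa [show (0 : ℝ) = L from hL0]
  exfalso
  have hA : 0 ≤ A := ge_of_tendsto' heA fun n =>
    div_nonneg (Finset.sum_nonneg fun k _ => by linarith [he k]) (by positivity)
  change 0 < L at hLpos
  -- Inside a window the steps of `ζ` add up to at most `(C' + C) / (N j) * (A + 1) j`, and this `N`
  -- makes that at most `L / 32`. The two corrections, each below `L / 64`, bring the motion of `v`
  -- to at most `L / 16`.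
  obtain ⟨N, hN⟩ := exists_nat_gt ((C' + C) * (A + 1) * 32 / L)
  have hN0 : (0 : ℝ) < N := lt_of_le_of_lt (by positivity) hN
  have hN1 : 1 ≤ N := by exact_mod_cast hN0
  obtain ⟨c, hc, hcu⟩ := hexc (L * r / 16) (by positivity)
  choose! π hπ hπt using hfreq
  have hNj : Tendsto (fun j : ℕ => N * j) atTop atTop := tendsto_id.const_mul_atTop' (by omega)
  -- events that hold for all large windows
  have ev1 := (tendsto_window_average heA hN1).eventually_lt_const (lt_add_one A)
  have ev2 : ∀ᶠ j : ℕ in atTop, ∀ p ∈ F, π p / 2 < (∑ k ∈ Finset.Ico (N * j) ((N + 1) * j),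
      (Metric.ball p (r / 8)).indicator (fun _ => (1 : ℝ)) (x k)) / j :=
    (eventually_all_finite hF).2 fun p hp =>
      (tendsto_window_average (hπt p hp) hN1).eventually_const_lt (half_lt_self (hπ p hp))
  -- The threshold is what `hlow` forces: at least `π p / 2 * j` visits to the ball, each costing at
  -- least `2 c / ((N+1) j)`.
  have ev3 : ∀ᶠ j : ℕ in atTop, ∀ p ∈ F, ∑ k ∈ Finset.Ico (N * j) ((N + 1) * j), D k <
      2 * c / (N + 1) * (π p / 2) :=
    (eventually_all_finite hF).2 fun p hp =>
      (tendsto_window_sum_zero hDsum hN1).eventually_lt_const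
        (mul_pos (by positivity) (half_pos (hπ p hp)))
  have ev4 : ∀ᶠ n : ℕ in atTop, ∀ k, n ≤ k → L / 2 < ‖v k‖ ∧ ‖s k‖ < L / 64 ∧ K ≤ k := by
    have h1 := hvL.eventually_const_lt (half_lt_self hLpos)
    have h2 := (tendsto_zero_iff_norm_tendsto_zero.1 hs0).eventually_lt_const
      (show (0 : ℝ) < L / 64 by positivity)
    have h3 := (h1.and (h2.and (eventually_ge_atTop K)))
    obtain ⟨n₀, hn₀⟩ := eventually_atTop.1 h3
    exact eventually_atTop.2 ⟨n₀, fun n hn k hk => hn₀ k (hn.trans hk)⟩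
  obtain ⟨j, w1, w2, w3, w4, hj⟩ := (ev1.and (ev2.and (ev3.and
    ((hNj.eventually ev4).and (eventually_ge_atTop 1))))).exists
  have hj0 : (0 : ℝ) < j := by exact_mod_cast hj
  set n := N * j with hn_def
  have hn1 : 1 ≤ n := Nat.mul_le_mul hN1 hj
  have hn0 : (0 : ℝ) < n := by exact_mod_cast hn1
  -- The ball is chosen by the direction of `v` at the start of the window. The direction varies
  -- with `j`, but finitely many balls suffice, so the frequency bounds already hold for the one
  -- selected.
  obtain ⟨p, hpF, hp⟩ := hcover ((r / 2 / ‖v n‖) • v n) (by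
    have : 0 < ‖v n‖ := by linarith [(w4 n le_rfl).1]
    rw [norm_smul, Real.norm_of_nonneg (by positivity)]
    field_simp)
  -- movement inside the window
  have hmove : ∀ m, n ≤ m → m < (N + 1) * j → ‖v m - v n‖ ≤ L / 16 := by
    intro m hnm hm
    have h1 : ‖ζ m - ζ n‖ ≤ ∑ k ∈ Finset.Ico n m, (C' + C) / n * e k := by
      refine norm_sub_le_sum_of_step_le hnm fun k hk _ => ?_
      have hk1 : 1 ≤ k := hn1.trans hk
      have hk0 : (0 : ℝ) < k := by exact_mod_cast hk1
      have hkK := (w4 k hk).2.2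
      have h2 : ζ (k + 1) - ζ k = (1 / (k : ℝ) * h (u k)) • x k
          + (1 / (k : ℝ) * (1 / ((k + 1 : ℕ) : ℝ))) • S (k + 1) := by
        simp only [hζ_def, hs_def]
        rw [hrec k hkK, corrected_step_eq _ _ _ _ hk1]
        abel
      rw [h2]
      refine (norm_add_le _ _).trans ?_
      have h3 := norm_correction_remainder_le hC hS hk1
      have h4 : C * (k : ℝ) ^ (-(9 / 8) : ℝ) ≤ C * (1 / k * e k) := by
        gcongr
        calc (k : ℝ) ^ (-(9 / 8) : ℝ) ≤ 1 / k * 1 := by rw [mul_one]; exact (rpow_bounds hk1).2.2.2.2.1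
          _ ≤ 1 / k * e k := by gcongr; exact he k
      have h5 : ‖(1 / (k : ℝ) * h (u k)) • x k‖ ≤ 1 / k * (C' * e k) := by
        rw [norm_smul, Real.norm_eq_abs, abs_mul, abs_of_nonneg (by positivity : 0 ≤ 1 / (k : ℝ)),
          mul_assoc]
        exact mul_le_mul_of_nonneg_left (hh k (v k) (hvR k hkK)) (by positivity)
      have h6 : 1 / (k : ℝ) ≤ 1 / n := by
        gcongr
      have h7 : 0 ≤ (C' + C) * e k := mul_nonneg (by positivity) (by linarith [he k])
      calc _ ≤ 1 / (k : ℝ) * ((C' + C) * e k) := by linarith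
        _ ≤ 1 / n * ((C' + C) * e k) := by gcongr
        _ = _ := by ring
    have h2 : ∑ k ∈ Finset.Ico n m, (C' + C) / n * e k ≤ L / 32 := by
      rw [← Finset.mul_sum]
      have h3 : ∑ k ∈ Finset.Ico n m, e k ≤ ∑ k ∈ Finset.Ico n ((N + 1) * j), e k :=
        Finset.sum_le_sum_of_subset_of_nonneg (Finset.Ico_subset_Ico le_rfl hm.le)
          fun k _ _ => by linarith [he k]
      rw [div_lt_iff₀ hj0] at w1
      calc (C' + C) / n * ∑ k ∈ Finset.Ico n m, e k ≤ (C' + C) / n * ((A + 1) * j) := by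
            gcongr
            exact h3.trans w1.le
        _ = (C' + C) * (A + 1) / N := by
            rw [hn_def]; push_cast; field_simp
        _ ≤ L / 32 := by
            rw [div_lt_iff₀ hLpos] at hN
            rw [div_le_div_iff₀ hN0 (by norm_num)]
            linarith
    have h3 : v m - v n = (ζ m - ζ n) + s m - s n := by simp only [hζ_def]; abel
    rw [h3]
    refine (norm_sub_le _ _).trans ?_
    have := norm_add_le (ζ m - ζ n) (s m)
    linarith [(w4 m hnm).2.1, (w4 n le_rfl).2.1]
  have hlow : 2 * c / (N + 1) * (π p / 2) ≤ ∑ k ∈ Finset.Ico n ((N + 1) * j), D k := by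
    have h1 := (w2 p hpF).le
    rw [le_div_iff₀ hj0] at h1
    calc 2 * c / (N + 1) * (π p / 2) = 2 * c / ((N + 1) * j) * (π p / 2 * j) := by field_simp
      _ ≤ 2 * c / ((N + 1) * j) * ∑ k ∈ Finset.Ico n ((N + 1) * j),
          (Metric.ball p (r / 8)).indicator (fun _ => (1 : ℝ)) (x k) := by gcongr
      _ ≤ _ := by
        rw [Finset.mul_sum]
        refine Finset.sum_le_sum fun k hk => ?_
        rw [Finset.mem_Ico] at hk
        by_cases hx : x k ∈ Metric.ball p (r / 8)
        · rw [Set.indicator_of_mem hx, mul_one]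
          have hk0 : (0 : ℝ) < k := by exact_mod_cast hn1.trans hk.1
          have h2 : L * r / 16 ≤ u k := le_inner_of_near hr hLpos (w4 n le_rfl).1.le
            (hmove k hk.1 hk.2) hp (by rwa [mem_ball_iff_norm] at hx)
          have h3 := hcu (u k) (h2.trans (le_abs_self _))
          have h4 : (k : ℝ) ≤ (N + 1) * j := by exact_mod_cast hk.2.le
          simp only [hD_def]
          calc 2 * c / ((N + 1) * j) ≤ 2 * c / k := by gcongr
            _ = 2 * (1 / (k : ℝ)) * c := by ring
            _ ≤ 2 * (1 / (k : ℝ)) * (-(u k * h (u k))) := by gcongr; linarith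
            _ = _ := by ring
        · rw [Set.indicator_of_notMem hx, mul_zero]
          exact hD0 k
  exact absurd (w3 p hpF) (not_lt.2 hlow)

lemma tendsto_counter_atTop {σ : ℕ → ℕ} {p : ℕ → Prop} [DecidablePred p] {k₀ : ℕ}
    (hσ : ∀ k, k₀ ≤ k → σ (k + 1) = σ k + if p k then 1 else 0)
    (hp : ∀ K, ∃ k, K ≤ k ∧ p k) : Tendsto σ atTop atTop := by
  have hmono : ∀ i j, k₀ ≤ i → i ≤ j → σ i ≤ σ j := by
    intro i j hi hij
    induction j, hij using Nat.le_induction with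
    | base => exact le_rfl
    | succ j hj ih => rw [hσ j (hi.trans hj)]; omega
  have hex : ∀ m, ∃ k, k₀ ≤ k ∧ m ≤ σ k := by
    intro m
    induction m with
    | zero => exact ⟨k₀, le_rfl, Nat.zero_le _⟩
    | succ m ih =>
      obtain ⟨k, hk, hm⟩ := ih
      obtain ⟨k', hk', hpk⟩ := hp k
      refine ⟨k' + 1, by omega, ?_⟩
      rw [hσ k' (hk.trans hk'), if_pos hpk]
      have := hmono k k' hk hk'
      omega
  refine tendsto_atTop.2 fun m => ?_
  obtain ⟨k, hk, hm⟩ := hex m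
  exact eventually_atTop.2 ⟨k, fun j hj => hm.trans (hmono k j hk hj)⟩

/-- Pathwise convergence of the algorithm with expanding truncations. -/
theorem tendsto_of_expanding_truncations {θ x z : ℕ → E} {σ : ℕ → ℕ} {θs : E} {M : ℕ → ℝ}
    {h : ℝ → ℝ} {e : ℕ → ℝ} {A r : ℝ} {k₀ : ℕ} (hk₀ : 1 ≤ k₀) (hM : Tendsto M atTop atTop)
    (hθ : ∀ k, k₀ ≤ k → θ (k + 1) =
      if ‖θ k + (1 / (k : ℝ)) • z k‖ ≤ M (σ k) then θ k + (1 / (k : ℝ)) • z k else 0)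
    (hσ : ∀ k, k₀ ≤ k → σ (k + 1) =
      σ k + if M (σ k) < ‖θ k + (1 / (k : ℝ)) • z k‖ then 1 else 0)
    (he : ∀ k, 1 ≤ e k)
    (hh : ∀ R : ℝ, 0 ≤ R → ∃ C, 0 ≤ C ∧
      ∀ k (v : E), ‖v‖ ≤ R → |h (inner ℝ v (x k))| * ‖x k‖ ≤ C * e k)
    (hnoise : ∀ R : ℕ, ∃ S : ℕ → E,
      (∃ C : ℝ, 0 ≤ C ∧ ∀ k : ℕ, 1 ≤ k → ‖S k‖ ≤ C * (k : ℝ) ^ (7 / 8 : ℝ)) ∧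
      ∀ k, k₀ ≤ k → ‖θ k‖ ≤ R →
        z k = h (inner ℝ (θ k - θs) (x k)) • x k + (S (k + 1) - S k))
    (hsum : Summable fun k : ℕ => (k : ℝ) ^ (-(9 / 8) : ℝ) * e k ^ 2)
    (hneg : ∀ u, u * h u ≤ 0) (hexc : ∀ a, 0 < a → ∃ c, 0 < c ∧ ∀ u, a ≤ |u| → u * h u ≤ -c)
    (heA : Tendsto (fun n : ℕ => (∑ k ∈ Finset.range n, e k) / n) atTop (𝓝 A))
    (hr : 0 < r) {F : Set E} (hF : F.Finite)
    (hcover : ∀ y : E, ‖y‖ = r / 2 → ∃ p ∈ F, ‖y - p‖ < r / 8)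
    (hfreq : ∀ p ∈ F, ∃ π, 0 < π ∧ Tendsto (fun n : ℕ =>
      (∑ k ∈ Finset.range n, (Metric.ball p (r / 8)).indicator (fun _ => (1 : ℝ)) (x k)) / n)
      atTop (𝓝 π)) :
    Tendsto θ atTop (𝓝 θs) := by
  have hfin : ∃ K, k₀ ≤ K ∧ ∀ k, K ≤ k → ‖θ k + (1 / (k : ℝ)) • z k‖ ≤ M (σ k) := by
    by_contra! hcon
    have hinf : ∀ K, ∃ k, K ≤ k ∧ M (σ k) < ‖θ k + (1 / (k : ℝ)) • z k‖ := fun K => by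
      obtain ⟨k, hk, hk'⟩ := hcon (max K k₀) (le_max_right _ _)
      exact ⟨k, (le_max_left _ _).trans hk, hk'⟩
    have hσt : Tendsto σ atTop atTop := tendsto_counter_atTop hσ hinf
    -- After a reset the corrected error stays within `‖θs‖ + 3/2`; adding back `θs` and a
    -- correction below `1/2` gives this radius.
    obtain ⟨R, hR⟩ := exists_nat_ge (2 * ‖θs‖ + 2)
    obtain ⟨S, ⟨C, hC, hS⟩, hz⟩ := hnoise R
    obtain ⟨C', hC', hh'⟩ := hh (R + ‖θs‖) (by positivity)
    obtain ⟨C₁, hC₁, hstep⟩ := exists_corrected_sq_le hC hC' (by positivity) he hS hh'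
    set ε : ℕ → ℝ := fun k => C₁ * ((k : ℝ) ^ (-(9 / 8) : ℝ) * e k ^ 2) with hε_def
    have hε0 : ∀ k, 0 ≤ ε k := fun k => by positivity
    have hε : Summable ε := hsum.mul_left C₁
    have hs0 : Tendsto (fun k : ℕ => (1 / (k : ℝ)) • S k) atTop (𝓝 0) := tendsto_correction_zero hS
    have ev1 := (tendsto_zero_iff_norm_tendsto_zero.1 hs0).eventually_lt_const
      (show (0 : ℝ) < 1 / 2 by norm_num)
    have ev2 := (hM.comp hσt).eventually_ge_atTop (R : ℝ)
    have ev3 := (tendsto_sum_nat_add ε).eventually_lt_const (show (0 : ℝ) < 1 by norm_num)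
    obtain ⟨K, hK⟩ := eventually_atTop.1 (ev1.and (ev2.and ev3))
    -- A truncation so late that the correction is below `1/2`, the bound is at least `R` and the
    -- remaining errors sum to less than 1. It resets the estimate to 0, where `‖ζ‖ ≤ ‖θs‖ + 1/2`.
    obtain ⟨k₁, hk₁, ht⟩ := hinf (max K k₀)
    have hKk : K ≤ k₁ := (le_max_left _ _).trans hk₁
    have hk₀k : k₀ ≤ k₁ := (le_max_right _ _).trans hk₁
    have hθ0 : θ (k₁ + 1) = 0 := by rw [hθ k₁ hk₀k, if_neg (not_le.2 ht)]
    set n₀ := k₁ + 1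
    set ζ : ℕ → E := fun k => θ k - θs - (1 / (k : ℝ)) • S k with hζ_def
    have hsmall : ∀ m, ∑ i ∈ Finset.range m, ε (i + n₀) ≤ 1 := fun m =>
      (((summable_nat_add_iff n₀).2 hε).sum_le_tsum _ fun i _ => hε0 _).trans
        (hK n₀ (by omega)).2.2.le
    have hbound : ∀ y : E, ∀ k, K ≤ k → ‖y - θs - (1 / (k : ℝ)) • S k‖ ^ 2 ≤
        (‖θs‖ + 1 / 2) ^ 2 + 1 → ‖y‖ ≤ R := by
      intro y k hk hy
      have h1 : ‖y - θs - (1 / (k : ℝ)) • S k‖ ≤ ‖θs‖ + 3 / 2 :=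
        abs_le_of_sq_le_sq' (by nlinarith [norm_nonneg θs]) (by positivity) |>.2
      have h2 : y = (y - θs - (1 / (k : ℝ)) • S k) + θs + (1 / (k : ℝ)) • S k := by abel
      have h3 := (hK k hk).1
      have h4 := norm_add_le ((y - θs - (1 / (k : ℝ)) • S k) + θs) ((1 / (k : ℝ)) • S k)
      have h5 := norm_add_le (y - θs - (1 / (k : ℝ)) • S k) θs
      rw [← h2] at h4
      linarith
    -- The invariant is propagated to the candidate, before it is known to be accepted; acceptance
    -- then follows from its norm being at most `R`.
    have hcand : ∀ m, ‖ζ (m + n₀)‖ ^ 2 ≤ (‖θs‖ + 1 / 2) ^ 2 + ∑ i ∈ Finset.range m, ε (i + n₀) →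
        let c := θ (m + n₀) + (1 / ((m + n₀ : ℕ) : ℝ)) • z (m + n₀)
        ‖c - θs - (1 / ((m + n₀ + 1 : ℕ) : ℝ)) • S (m + n₀ + 1)‖ ^ 2 ≤
          (‖θs‖ + 1 / 2) ^ 2 + ∑ i ∈ Finset.range (m + 1), ε (i + n₀) ∧ ‖c‖ ≤ M (σ (m + n₀)) := by
      intro m hm c
      have hRm : ‖θ (m + n₀)‖ ≤ R := hbound _ (m + n₀) (by omega) (hm.trans (by linarith [hsmall m]))
      have h1 := hstep (m + n₀) (by omega) (θ (m + n₀) - θs)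
        ((norm_sub_le _ _).trans (by linarith))
      rw [← hz (m + n₀) (by omega) hRm] at h1
      have h2 : c - θs = θ (m + n₀) - θs + (1 / ((m + n₀ : ℕ) : ℝ)) • z (m + n₀) := by
        simp only [c]; abel
      rw [← h2] at h1
      have h3 : 2 * (1 / ((m + n₀ : ℕ) : ℝ)) * (inner ℝ (θ (m + n₀) - θs) (x (m + n₀)) *
          h (inner ℝ (θ (m + n₀) - θs) (x (m + n₀)))) ≤ 0 :=
        mul_nonpos_of_nonneg_of_nonpos (by positivity) (hneg _)
      have h4 : ‖c - θs - (1 / ((m + n₀ + 1 : ℕ) : ℝ)) • S (m + n₀ + 1)‖ ^ 2 ≤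
          (‖θs‖ + 1 / 2) ^ 2 + ∑ i ∈ Finset.range (m + 1), ε (i + n₀) := by
        rw [Finset.sum_range_succ]
        simp only [hζ_def, hε_def] at hm ⊢
        linarith
      refine ⟨h4, ?_⟩
      exact (hbound c (m + n₀ + 1) (by omega) (h4.trans (by linarith [hsmall (m + 1)]))).trans
        (hK (m + n₀) (by omega)).2.1
    have hζb : ∀ m, ‖ζ (m + n₀)‖ ^ 2 ≤
        (‖θs‖ + 1 / 2) ^ 2 + ∑ i ∈ Finset.range m, ε (i + n₀) := by
      intro m
      induction m with
      | zero =>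
        simp only [zero_add, Finset.range_zero, Finset.sum_empty, add_zero, hζ_def, hθ0]
        have h1 := norm_sub_le (0 - θs) ((1 / (n₀ : ℝ)) • S n₀)
        rw [zero_sub, norm_neg] at h1
        have h2 := (hK n₀ (by omega)).1
        rw [zero_sub]
        gcongr
        linarith
      | succ m ih =>
        obtain ⟨h1, h2⟩ := hcand m ih
        have h3 := hθ (m + n₀) (by omega)
        rw [if_pos h2] at h3
        rw [show m + 1 + n₀ = m + n₀ + 1 by ring]
        simp only [hζ_def]
        rw [h3]
        exact h1
    obtain ⟨k₂, hk₂, ht₂⟩ := hinf n₀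
    obtain ⟨m, rfl⟩ : ∃ m, k₂ = m + n₀ := ⟨k₂ - n₀, by omega⟩
    exact absurd ht₂ (not_lt.2 (hcand m (hζb m)).2)
  obtain ⟨K, hK, hKt⟩ := hfin
  -- With no further truncations the counter freezes, so `M (σ K)` bounds all later estimates and
  -- the recursion without truncation applies.
  have hσc : ∀ k, K ≤ k → σ k = σ K := by
    intro k hk
    induction k, hk using Nat.le_induction with
    | base => rfl
    | succ j hj ih => rw [hσ j (hK.trans hj), if_neg (not_lt.2 (hKt j hj)), ih, add_zero]
  have hθn : ∀ k, K ≤ k → θ (k + 1) = θ k + (1 / (k : ℝ)) • z k := fun k hk => by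
    rw [hθ k (hK.trans hk), if_pos (hKt k hk)]
  obtain ⟨R, hR⟩ := exists_nat_ge (M (σ K))
  have hθR : ∀ k, K + 1 ≤ k → ‖θ k‖ ≤ R := by
    intro k hk
    obtain ⟨j, rfl⟩ : ∃ j, k = j + 1 := ⟨k - 1, by omega⟩
    rw [hθn j (by omega)]
    refine (hKt j (by omega)).trans ?_
    rwa [hσc j (by omega)]
  obtain ⟨S, ⟨C, hC, hS⟩, hz⟩ := hnoise R
  obtain ⟨C', hC', hh'⟩ := hh (R + ‖θs‖) (by positivity)
  have := tendsto_zero_of_bounded_recursion (v := fun k => θ k - θs) (K := K + 1) (by omega)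
    hC hC' (by positivity) he hS hh' hsum hneg hexc
    (fun k hk => (norm_sub_le _ _).trans (by linarith [hθR k hk]))
    (fun k hk => by
      rw [← hz k (by omega) (hθR k hk), hθn k (by omega)]
      abel) heA hr hF hcover hfreq
  exact tendsto_sub_nhds_zero_iff.1 this

end Deterministic

/-! ### Almost sure growth of partial sums from second moments -/

section SecondMoment

variable {Ω : Type*} [MeasurableSpace Ω] {P : Measure Ω}

lemma ae_summable_of_summable_integral {Y : ℕ → Ω → ℝ} (hY : ∀ k, Integrable (Y k) P)
    (h0 : ∀ k ω, 0 ≤ Y k ω) {b : ℕ → ℝ} (hb : ∀ k, ∫ ω, Y k ω ∂P ≤ b k) (hs : Summable b) :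
    ∀ᵐ ω ∂P, Summable fun k => Y k ω := by
  have hb0 : ∀ k, 0 ≤ b k := fun k => (integral_nonneg (h0 k)).trans (hb k)
  have h1 : ∫⁻ ω, ∑' k, ENNReal.ofReal (Y k ω) ∂P ≠ ∞ := by
    rw [lintegral_tsum fun k => (hY k).1.aemeasurable.ennreal_ofReal]
    refine ne_top_of_le_ne_top (hs.tsum_ofReal_ne_top) (ENNReal.tsum_le_tsum fun k => ?_)
    rw [← ofReal_integral_eq_lintegral_ofReal (hY k) (ae_of_all _ (h0 k))]
    exact ENNReal.ofReal_le_ofReal (hb k)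
  have h2 := ae_lt_top' (AEMeasurable.tsum fun k => (hY k).1.aemeasurable.ennreal_ofReal) h1
  filter_upwards [h2] with ω hω
  have h3 := ENNReal.summable_toReal hω.ne
  exact h3.congr fun k => by rw [ENNReal.toReal_ofReal (h0 k ω)]

/-- Linear growth of the second moment of the partial sums under geometric decay of correlations. -/
lemma integral_sq_sum_le {X : ℕ → Ω → ℝ} {C r : ℝ} (hX : ∀ k, MemLp (X k) 2 P) (hC : 0 ≤ C)
    (hr0 : 0 ≤ r) (hr1 : r < 1) (h2 : ∀ k, ∫ ω, X k ω ^ 2 ∂P ≤ C)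
    (hcov : ∀ i n, i < n → ∫ ω, X i ω * X n ω ∂P ≤ C * r ^ (n - i)) (n : ℕ) :
    ∫ ω, (∑ k ∈ Finset.range n, X k ω) ^ 2 ∂P ≤ (C + 2 * C * (1 - r)⁻¹) * n := by
  induction n with
  | zero => simp
  | succ n ih =>
    have hint : ∀ i j, Integrable (fun ω => X i ω * X j ω) P := fun i j =>
      (hX i).integrable_mul (hX j)
    have hS : MemLp (fun ω => ∑ k ∈ Finset.range n, X k ω) 2 P :=
      memLp_finsetSum _ fun k _ => hX k
    have h3 : ∀ ω, (∑ k ∈ Finset.range (n + 1), X k ω) ^ 2 = (∑ k ∈ Finset.range n, X k ω) ^ 2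
        + 2 * ∑ k ∈ Finset.range n, X k ω * X n ω + X n ω ^ 2 := fun ω => by
      rw [Finset.sum_range_succ, ← Finset.sum_mul]; ring
    have i1 : Integrable (fun ω => 2 * ∑ k ∈ Finset.range n, X k ω * X n ω) P :=
      (integrable_finsetSum _ fun k _ => hint k n).const_mul 2
    simp_rw [h3]
    have i2 : Integrable (fun ω => (∑ k ∈ Finset.range n, X k ω) ^ 2
        + 2 * ∑ k ∈ Finset.range n, X k ω * X n ω) P := hS.integrable_sq.add i1
    rw [integral_add i2 (hX n).integrable_sq,
      integral_add hS.integrable_sq i1, integral_const_mul,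
      integral_finsetSum _ fun k _ => hint k n]
    have h4 : ∑ k ∈ Finset.range n, ∫ ω, X k ω * X n ω ∂P ≤ C * (1 - r)⁻¹ := by
      calc ∑ k ∈ Finset.range n, ∫ ω, X k ω * X n ω ∂P
          ≤ ∑ k ∈ Finset.range n, C * r ^ (n - k) :=
            Finset.sum_le_sum fun k hk => hcov k n (Finset.mem_range.1 hk)
        _ = C * ∑ k ∈ Finset.range n, r ^ (k + 1) := by
            rw [← Finset.mul_sum, ← Finset.sum_range_reflect]
            congr 1
            refine Finset.sum_congr rfl fun k hk => ?_
            rw [Finset.mem_range] at hk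
            congr 1
            omega
        _ ≤ C * ∑ k ∈ Finset.range n, r ^ k := by
            refine mul_le_mul_of_nonneg_left (Finset.sum_le_sum fun k _ => ?_) hC
            exact pow_le_pow_of_le_one hr0 hr1.le (Nat.le_succ k)
        _ ≤ C * (1 - r)⁻¹ := by
            gcongr
            rw [← tsum_geometric_of_lt_one hr0 hr1]
            exact (summable_geometric_of_lt_one hr0 hr1).sum_le_tsum _ fun i _ => by positivity
    have := h2 n
    push_cast
    linarith

/-- Partial sums with linearly growing second moments are almost surely `O(n ^ (7 / 8))`. -/
lemma ae_sum_le_rpow {X : ℕ → Ω → ℝ} {C : ℝ} (hX : ∀ k, MemLp (X k) 2 P)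
    (h2 : ∀ k, ∫ ω, X k ω ^ 2 ∂P ≤ C)
    (hsum : ∀ n : ℕ, ∫ ω, (∑ k ∈ Finset.range n, X k ω) ^ 2 ∂P ≤ C * n) :
    ∀ᵐ ω ∂P, ∃ B : ℝ, 0 ≤ B ∧ ∀ n : ℕ, 1 ≤ n →
      |∑ k ∈ Finset.range n, X k ω| ≤ B * (n : ℝ) ^ (7 / 8 : ℝ) := by
  have hC : 0 ≤ C := (integral_nonneg fun ω => sq_nonneg _).trans (h2 0)
  -- `Q j` controls every partial sum with index between `j ^ 2` and `(j + 1) ^ 2`: the sum up to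
  -- the square, and by Cauchy–Schwarz the rest of a block of length `2 j + 1`.
  set Q : ℕ → Ω → ℝ := fun j ω => (∑ k ∈ Finset.range (j ^ 2), X k ω) ^ 2
    + (2 * j + 1) * ∑ k ∈ Finset.Ico (j ^ 2) ((j + 1) ^ 2), X k ω ^ 2 with hQ
  have hQ0 : ∀ j ω, 0 ≤ Q j ω := fun j ω => by
    have := Finset.sum_nonneg fun k (_ : k ∈ Finset.Ico (j ^ 2) ((j + 1) ^ 2)) => sq_nonneg (X k ω)
    positivity
  have hSi : ∀ n, Integrable (fun ω => (∑ k ∈ Finset.range n, X k ω) ^ 2) P := fun n =>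
    (memLp_finsetSum _ fun k _ => hX k).integrable_sq
  have hTi : ∀ j : ℕ, Integrable (fun ω => (2 * (j : ℝ) + 1) *
      ∑ k ∈ Finset.Ico (j ^ 2) ((j + 1) ^ 2), X k ω ^ 2) P := fun j =>
    (integrable_finsetSum _ fun k _ => (hX k).integrable_sq).const_mul _
  have hQi : ∀ j, Integrable (Q j) P := fun j => (hSi _).add (hTi j)
  have hQb : ∀ j : ℕ, ∫ ω, Q j ω ∂P ≤ C * j ^ 2 + (2 * j + 1) * ((2 * j + 1) * C) := by
    intro j
    simp only [hQ]
    rw [integral_add (hSi _) (hTi j), integral_const_mul,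
      integral_finsetSum _ fun k _ => (hX k).integrable_sq]
    have h3 := hsum (j ^ 2)
    push_cast at h3
    have h4 : ∑ k ∈ Finset.Ico (j ^ 2) ((j + 1) ^ 2), ∫ ω, X k ω ^ 2 ∂P ≤ (2 * j + 1) * C := by
      refine (Finset.sum_le_card_nsmul _ _ C fun k _ => h2 k).trans (le_of_eq ?_)
      rw [Nat.card_Ico, nsmul_eq_mul, show (j + 1) ^ 2 - j ^ 2 = 2 * j + 1 by
        rw [show (j + 1) ^ 2 = j ^ 2 + (2 * j + 1) by ring, Nat.add_sub_cancel_left]]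
      push_cast; ring
    gcongr
  -- The mean of `Q j` is at most `10 C j^2` for `j ≥ 1`, so the weight `j^(-7/2)` leaves the
  -- summable `j^(-3/2)`. Hence `Q j = O(j^(7/2))`, and sums up to `n`, with `j = √n` rounded down,
  -- are `O(j^(7/4)) = O(n^(7/8))`. At `j = 0` the weight is 0.
  have hae := ae_summable_of_summable_integral (P := P)
    (Y := fun j ω => (j : ℝ) ^ (-(7 / 2) : ℝ) * Q j ω)
    (b := fun j : ℕ => 10 * C * (j : ℝ) ^ (-(3 / 2) : ℝ)) (fun j => (hQi j).const_mul _)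
    (fun j ω => mul_nonneg (by positivity) (hQ0 j ω)) (fun j => by
      rw [integral_const_mul]
      rcases Nat.eq_zero_or_pos j with rfl | hj
      · simp [Real.zero_rpow]
      have hj1 : (1 : ℝ) ≤ j := by exact_mod_cast hj
      have h3 : (j : ℝ) ^ (-(3 / 2) : ℝ) = (j : ℝ) ^ (-(7 / 2) : ℝ) * (j : ℝ) ^ 2 := by
        rw [← Real.rpow_natCast, ← Real.rpow_add (by linarith)]; norm_num
      rw [h3]
      calc (j : ℝ) ^ (-(7 / 2) : ℝ) * ∫ ω, Q j ω ∂P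
          ≤ (j : ℝ) ^ (-(7 / 2) : ℝ) * (10 * C * j ^ 2) := by
            gcongr
            refine (hQb j).trans ?_
            nlinarith [mul_nonneg hC (sub_nonneg.2 hj1), mul_nonneg hC (mul_nonneg (sub_nonneg.2 hj1)
              (sub_nonneg.2 hj1))]
        _ = _ := by ring)
    ((Real.summable_nat_rpow.2 (by norm_num)).mul_left _)
  filter_upwards [hae] with ω hω
  obtain ⟨B, hB⟩ := hω.tendsto_atTop_zero.bddAbove_range
  have hB' : ∀ j : ℕ, (j : ℝ) ^ (-(7 / 2) : ℝ) * Q j ω ≤ B := fun j => hB ⟨j, rfl⟩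
  have hB0 : 0 ≤ B := (mul_nonneg (by positivity) (hQ0 0 ω)).trans (hB' 0)
  refine ⟨2 * √B, by positivity, fun n hn => ?_⟩
  set j := Nat.sqrt n
  have hj1 : 1 ≤ j := Nat.sqrt_pos.2 hn
  have hjn : j ^ 2 ≤ n := Nat.sqrt_le' n
  have hnj : n < (j + 1) ^ 2 := Nat.lt_succ_sqrt' n
  have hj0 : (0 : ℝ) < j := by exact_mod_cast hj1
  have hQj : Q j ω ≤ (√B * (j : ℝ) ^ (7 / 4 : ℝ)) ^ 2 := by
    have h3 := hB' j
    rw [Real.rpow_neg hj0.le, inv_mul_le_iff₀ (by positivity)] at h3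
    rw [mul_pow, Real.sq_sqrt hB0, ← Real.rpow_natCast ((j : ℝ) ^ (7 / 4 : ℝ)), ← Real.rpow_mul hj0.le]
    norm_num
    linarith
  have hT0 : 0 ≤ ∑ k ∈ Finset.Ico (j ^ 2) ((j + 1) ^ 2), X k ω ^ 2 :=
    Finset.sum_nonneg fun k _ => sq_nonneg _
  have hS1 : |∑ k ∈ Finset.range (j ^ 2), X k ω| ≤ √B * (j : ℝ) ^ (7 / 4 : ℝ) := by
    refine abs_le_of_sq_le_sq (le_trans ?_ hQj) (by positivity)
    simp only [hQ]
    have : 0 ≤ (2 * (j : ℝ) + 1) * ∑ k ∈ Finset.Ico (j ^ 2) ((j + 1) ^ 2), X k ω ^ 2 := by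
      positivity
    linarith
  have hS2 : |∑ k ∈ Finset.Ico (j ^ 2) n, X k ω| ≤ √B * (j : ℝ) ^ (7 / 4 : ℝ) := by
    refine abs_le_of_sq_le_sq (le_trans ?_ hQj) (by positivity)
    refine sq_sum_le_card_mul_sum_sq.trans ?_
    have h4 : ((Finset.Ico (j ^ 2) n).card : ℝ) ≤ 2 * j + 1 := by
      rw [Nat.card_Ico]
      have : n - j ^ 2 ≤ 2 * j + 1 := by
        have : (j + 1) ^ 2 = j ^ 2 + (2 * j + 1) := by ring
        omega
      exact_mod_cast this
    have h5 : ∑ k ∈ Finset.Ico (j ^ 2) n, X k ω ^ 2 ≤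
        ∑ k ∈ Finset.Ico (j ^ 2) ((j + 1) ^ 2), X k ω ^ 2 :=
      Finset.sum_le_sum_of_subset_of_nonneg (Finset.Ico_subset_Ico le_rfl hnj.le)
        fun k _ _ => sq_nonneg _
    simp only [hQ]
    have h6 : ((Finset.Ico (j ^ 2) n).card : ℝ) * ∑ k ∈ Finset.Ico (j ^ 2) n, X k ω ^ 2 ≤
        (2 * j + 1) * ∑ k ∈ Finset.Ico (j ^ 2) ((j + 1) ^ 2), X k ω ^ 2 := by gcongr
    linarith [sq_nonneg (∑ k ∈ Finset.range (j ^ 2), X k ω)]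
  have h7 : (j : ℝ) ^ (7 / 4 : ℝ) ≤ (n : ℝ) ^ (7 / 8 : ℝ) := by
    have h8 : (j : ℝ) ^ (7 / 4 : ℝ) = ((j : ℝ) ^ 2) ^ (7 / 8 : ℝ) := by
      rw [← Real.rpow_natCast (j : ℝ) 2, ← Real.rpow_mul hj0.le]; norm_num
    rw [h8]
    exact Real.rpow_le_rpow (by positivity) (by exact_mod_cast hjn) (by norm_num)
  rw [← Finset.sum_range_add_sum_Ico _ hjn]
  calc _ ≤ |∑ k ∈ Finset.range (j ^ 2), X k ω| + |∑ k ∈ Finset.Ico (j ^ 2) n, X k ω| := abs_add_le _ _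
    _ ≤ 2 * √B * (j : ℝ) ^ (7 / 4 : ℝ) := by linarith
    _ ≤ _ := by gcongr

/-- Square integrable variables with geometrically decaying correlations have partial sums of
order `O(n ^ (7 / 8))`. -/
theorem ae_sum_le_rpow_of_geometric_decay {X : ℕ → Ω → ℝ} {C r : ℝ} (hX : ∀ k, MemLp (X k) 2 P)
    (hr0 : 0 ≤ r) (hr1 : r < 1) (h2 : ∀ k, ∫ ω, X k ω ^ 2 ∂P ≤ C)
    (hcov : ∀ i n, i < n → ∫ ω, X i ω * X n ω ∂P ≤ C * r ^ (n - i)) :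
    ∀ᵐ ω ∂P, ∃ B : ℝ, 0 ≤ B ∧ ∀ n : ℕ, 1 ≤ n →
      |∑ k ∈ Finset.range n, X k ω| ≤ B * (n : ℝ) ^ (7 / 8 : ℝ) := by
  have hC : 0 ≤ C := (integral_nonneg fun ω => sq_nonneg _).trans (h2 0)
  have hr : 0 ≤ 2 * C * (1 - r)⁻¹ := by
    have : 0 < 1 - r := by linarith
    positivity
  exact ae_sum_le_rpow hX (fun k => (h2 k).trans (by linarith))
    (integral_sq_sum_le hX hC hr0 hr1 h2 hcov)

lemma tendsto_average_of_sum_le_rpow {f : ℕ → ℝ} {m B : ℝ}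
    (h : ∀ n : ℕ, 1 ≤ n → |∑ k ∈ Finset.range n, (f k - m)| ≤ B * (n : ℝ) ^ (7 / 8 : ℝ)) :
    Tendsto (fun n : ℕ => (∑ k ∈ Finset.range n, f k) / n) atTop (𝓝 m) := by
  have h1 := tendsto_correction_zero (S := fun n => ∑ k ∈ Finset.range n, (f k - m)) (C := B) h
  have h2 := h1.add_const m
  rw [zero_add] at h2
  refine h2.congr' ?_
  filter_upwards [eventually_ge_atTop 1] with n hn
  have hn0 : (0 : ℝ) < n := by exact_mod_cast hn
  simp only [Finset.sum_sub_distrib, Finset.sum_const, Finset.card_range, nsmul_eq_mul, smul_eq_mul]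
  field_simp
  ring

end SecondMoment

/-! ### Covariance inequalities and a strong law with rate under mixing -/

section Mixing

variable {Ω S : Type*} [MeasurableSpace Ω] [MeasurableSpace S] {P : Measure Ω}

/-- Only the upper half of the mixing inequality, for events at two single times, is kept: second
moments of sums need covariances bounded from above only. -/
lemma measure_inter_le_of_phiMixing [IsFiniteMeasure P] {z : ℕ → Ω → S} {a : ℝ}
    (ha : 0 ≤ a) {i k : ℕ} (hmix : phiMixingCoeff P z k ≤ ENNReal.ofReal a) {s t : Set S} (hs : MeasurableSet s)
    (ht : MeasurableSet t) :
    P (z i ⁻¹' s ∩ z (i + k) ⁻¹' t) ≤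
      (P (z (i + k) ⁻¹' t) + ENNReal.ofReal a) * P (z i ⁻¹' s) := by
  -- Null events are excluded from the supremum defining the coefficient.
  rcases eq_or_ne (P (z i ⁻¹' s)) 0 with h0 | h0
  · rw [measure_mono_null Set.inter_subset_left h0]
    exact zero_le
  have hA : MeasurableSet[sigmaPast z i] (z i ⁻¹' s) := by
    have : MeasurableSpace.comap (z i) inferInstance ≤ sigmaPast z i :=
      le_iSup₂_of_le (f := fun j (_ : j ≤ i) => MeasurableSpace.comap (z j) inferInstance)
        i le_rfl le_rfl
    exact this _ ⟨s, hs, rfl⟩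
  have hB : MeasurableSet[sigmaFuture z (i + k)] (z (i + k) ⁻¹' t) := by
    have : MeasurableSpace.comap (z (i + k)) inferInstance ≤ sigmaFuture z (i + k) :=
      le_iSup₂_of_le (f := fun j (_ : i + k ≤ j) => MeasurableSpace.comap (z j) inferInstance)
        (i + k) le_rfl le_rfl
    exact this _ ⟨t, ht, rfl⟩
  have h1 : ENNReal.ofReal (|P.real (z i ⁻¹' s ∩ z (i + k) ⁻¹' t)
      - P.real (z i ⁻¹' s) * P.real (z (i + k) ⁻¹' t)| / P.real (z i ⁻¹' s)) ≤
      ENNReal.ofReal a := by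
    refine le_trans ?_ hmix
    unfold phiMixingCoeff
    refine le_iSup_of_le i (le_iSup_of_le _ (le_iSup_of_le _ (le_iSup_of_le hA
      (le_iSup_of_le (pos_iff_ne_zero.2 h0) (le_iSup_of_le hB le_rfl)))))
  have hpos : 0 < P.real (z i ⁻¹' s) := ENNReal.toReal_pos h0 (measure_ne_top _ _)
  rw [ENNReal.ofReal_le_ofReal_iff ha, div_le_iff₀ hpos] at h1
  have h2 := (le_abs_self _).trans h1
  rw [← ofReal_measureReal (measure_ne_top P (z i ⁻¹' s ∩ z (i + k) ⁻¹' t)),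
    ← ofReal_measureReal (measure_ne_top P (z i ⁻¹' s)),
    ← ofReal_measureReal (measure_ne_top P (z (i + k) ⁻¹' t)),
    ← ENNReal.ofReal_add measureReal_nonneg ha,
    ← ENNReal.ofReal_mul (add_nonneg measureReal_nonneg ha)]
  exact ENNReal.ofReal_le_ofReal (by linarith)

/-- One-sided covariance inequality for a nonnegative and a bounded nonnegative function. -/
lemma lintegral_mul_le_of_measure_inter_le {X Y : Ω → S} (hX : Measurable X) (hY : Measurable Y)
    {α : ℝ≥0∞} (hmix : ∀ s t : Set S, MeasurableSet s → MeasurableSet t →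
      P (X ⁻¹' s ∩ Y ⁻¹' t) ≤ (P (Y ⁻¹' t) + α) * P (X ⁻¹' s))
    {f : S → ℝ≥0∞} (hf : Measurable f) {g : S → ℝ} (hg : Measurable g) (hg0 : ∀ y, 0 ≤ g y)
    {K : ℝ} (hgK : ∀ y, g y ≤ K) :
    ∫⁻ ω, f (X ω) * ENNReal.ofReal (g (Y ω)) ∂P ≤
      (∫⁻ ω, ENNReal.ofReal (g (Y ω)) ∂P + α * ENNReal.ofReal K) * ∫⁻ ω, f (X ω) ∂P := by
  -- For fixed `t` the hypothesis says that one measure in `s` dominates another, so it can be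
  -- integrated against `f`.
  have hset : ∀ t : Set S, MeasurableSet t →
      ∫⁻ ω in Y ⁻¹' t, f (X ω) ∂P ≤ (P (Y ⁻¹' t) + α) * ∫⁻ ω, f (X ω) ∂P := by
    intro t ht
    have hle : (P.restrict (Y ⁻¹' t)).map X ≤ (P (Y ⁻¹' t) + α) • P.map X := by
      refine Measure.le_iff.2 fun s hs => ?_
      rw [Measure.map_apply hX hs, Measure.restrict_apply (hX hs), Measure.smul_apply,
        Measure.map_apply hX hs, smul_eq_mul]
      exact hmix s t hs ht
    rw [← lintegral_map hf hX, ← lintegral_map hf hX, ← smul_eq_mul, ← lintegral_smul_measure]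
    exact lintegral_mono' hle le_rfl
  have hfX : Measurable fun ω => f (X ω) := hf.comp hX
  have hgY : Measurable fun ω => g (Y ω) := hg.comp hY
  have h1 : ∫⁻ ω, f (X ω) * ENNReal.ofReal (g (Y ω)) ∂P =
      ∫⁻ ω, ENNReal.ofReal (g (Y ω)) ∂(P.withDensity fun ω => f (X ω)) :=
    (lintegral_withDensity_eq_lintegral_mul _ hfX hgY.ennreal_ofReal).symm
  rw [h1, lintegral_eq_lintegral_meas_lt _ (ae_of_all _ fun ω => hg0 _) hgY.aemeasurable,
    lintegral_eq_lintegral_meas_lt P (ae_of_all _ fun ω => hg0 _) hgY.aemeasurable]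
  set I := ∫⁻ ω, f (X ω) ∂P
  -- Layer-cake formula for `g (Y)` under the measure with density `f (X)`. Levels above `K` are
  -- empty, so `α` is integrated over `(0, K)` only.
  have h2 : ∀ t : ℝ, (P.withDensity fun ω => f (X ω)) {ω | t < g (Y ω)} ≤
      (P {ω | t < g (Y ω)} + (Set.Iio K).indicator (fun _ => α) t) * I := by
    intro t
    have hm : MeasurableSet {y | t < g y} := measurableSet_lt measurable_const hg
    rcases lt_or_ge t K with htK | htK
    · rw [Set.indicator_of_mem (show t ∈ Set.Iio K from htK)]
      have hm' : MeasurableSet {ω | t < g (Y ω)} := hY hm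
      rw [withDensity_apply _ hm']
      exact hset _ hm
    · have : {ω | t < g (Y ω)} = ∅ := by
        ext ω; simpa using (hgK (Y ω)).trans htK
      rw [this]; simp
  have hanti : Measurable fun t : ℝ => P {ω | t < g (Y ω)} :=
    (show Antitone fun t : ℝ => P {ω | t < g (Y ω)} from fun a b hab =>
      measure_mono fun ω (hω : b < g (Y ω)) => lt_of_le_of_lt hab hω).measurable
  calc _ ≤ ∫⁻ t in Set.Ioi (0 : ℝ),
        (P {ω | t < g (Y ω)} + (Set.Iio K).indicator (fun _ => α) t) * I :=
        lintegral_mono fun t => h2 t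
    _ = ((∫⁻ t in Set.Ioi (0 : ℝ), P {ω | t < g (Y ω)}) + α * ENNReal.ofReal K) * I := by
        have hm : Measurable fun t : ℝ =>
            P {ω | t < g (Y ω)} + (Set.Iio K).indicator (fun _ => α) t :=
          hanti.add (measurable_const.indicator measurableSet_Iio)
        rw [lintegral_mul_const _ hm, lintegral_add_left hanti, lintegral_indicator_const measurableSet_Iio,
          Measure.restrict_apply measurableSet_Iio, Set.inter_comm, Set.Ioi_inter_Iio,
          Real.volume_Ioo, sub_zero]

/-- One-sided covariance inequality for a nonnegative function with a moment of order `2 + δ`. -/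
lemma integral_mul_le_of_measure_inter_le {X Y : Ω → S} (hX : Measurable X) (hY : Measurable Y)
    {a : ℝ} (ha : 0 ≤ a) (hmix : ∀ s t : Set S, MeasurableSet s → MeasurableSet t →
      P (X ⁻¹' s ∩ Y ⁻¹' t) ≤ (P (Y ⁻¹' t) + ENNReal.ofReal a) * P (X ⁻¹' s))
    {f : S → ℝ} (hf : Measurable f) (hf0 : ∀ y, 0 ≤ f y) {δ : ℝ} (hδ : 0 < δ) {m A : ℝ}
    (hXi : Integrable (fun ω => f (X ω)) P) (hYi : Integrable (fun ω => f (Y ω)) P)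
    (hmX : ∫ ω, f (X ω) ∂P = m) (hmY : ∫ ω, f (Y ω) ∂P = m)
    (hXδ : Integrable (fun ω => f (X ω) ^ (2 + δ)) P)
    (hYδ : Integrable (fun ω => f (Y ω) ^ (2 + δ)) P)
    (hAX : ∫ ω, f (X ω) ^ (2 + δ) ∂P ≤ A) (hAY : ∫ ω, f (Y ω) ^ (2 + δ) ∂P ≤ A)
    {K : ℝ} (hK : 0 < K) :
    ∫ ω, f (X ω) * f (Y ω) ∂P ≤ m ^ 2 + a * K * m + K ^ (-δ) * (2 * A) := by
  have hm0 : 0 ≤ m := hmX ▸ integral_nonneg fun ω => hf0 _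
  set g : S → ℝ := fun y => min (f y) K with hg_def
  have hg : Measurable g := hf.min measurable_const
  have hg0 : ∀ y, 0 ≤ g y := fun y => le_min (hf0 y) hK.le
  have hfX : Measurable fun ω => f (X ω) := hf.comp hX
  have hgY : Measurable fun ω => g (Y ω) := hg.comp hY
  have hgi : Integrable (fun ω => g (Y ω)) P :=
    hYi.mono' hgY.aestronglyMeasurable (ae_of_all _ fun ω => by
      rw [Real.norm_of_nonneg (hg0 _)]; exact min_le_left _ _)
  have hfgi : Integrable (fun ω => f (X ω) * g (Y ω)) P :=
    (hXi.mul_const K).mono' (hfX.mul hgY).aestronglyMeasurable (ae_of_all _ fun ω => by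
      rw [Real.norm_of_nonneg (mul_nonneg (hf0 _) (hg0 _))]
      exact mul_le_mul_of_nonneg_left (min_le_right _ _) (hf0 _))
  have h1 : ∫ ω, f (X ω) * g (Y ω) ∂P ≤ (m + a * K) * m := by
    have h2 := lintegral_mul_le_of_measure_inter_le hX hY hmix hf.ennreal_ofReal hg hg0
      (K := K) (fun y => min_le_right _ _)
    simp_rw [← ENNReal.ofReal_mul (hf0 _)] at h2
    rw [← ofReal_integral_eq_lintegral_ofReal hfgi (ae_of_all _ fun ω => mul_nonneg (hf0 _) (hg0 _)),
      ← ofReal_integral_eq_lintegral_ofReal hgi (ae_of_all _ fun ω => hg0 _),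
      ← ofReal_integral_eq_lintegral_ofReal hXi (ae_of_all _ fun ω => hf0 _), hmX,
      ← ENNReal.ofReal_mul ha, ← ENNReal.ofReal_add (integral_nonneg fun ω => hg0 _) (by positivity),
      ← ENNReal.ofReal_mul (add_nonneg (integral_nonneg fun ω => hg0 _) (by positivity))] at h2
    have hgm : ∫ ω, g (Y ω) ∂P ≤ m := hmY ▸ integral_mono hgi hYi fun ω => min_le_left _ _
    rw [ENNReal.ofReal_le_ofReal_iff (mul_nonneg
      (add_nonneg (integral_nonneg fun ω => hg0 _) (by positivity)) hm0)] at h2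
    refine h2.trans ?_
    gcongr
  -- Price of capping `f (Y)` at `K`: where `f (Y) > K` one has `1 ≤ K^(-δ) f(Y)^δ`, and the
  -- resulting product is at most the `(2+δ)`-th power of the larger factor.
  have hpt : ∀ ω, f (X ω) * f (Y ω) ≤
      f (X ω) * g (Y ω) + K ^ (-δ) * (f (X ω) ^ (2 + δ) + f (Y ω) ^ (2 + δ)) := by
    intro ω
    have hp := hf0 (X ω)
    have hq := hf0 (Y ω)
    set p := f (X ω)
    set q := f (Y ω) with hq_def
    have hKδ : 0 < K ^ (-δ) := Real.rpow_pos_of_pos hK _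
    have hpp : 0 ≤ p ^ (2 + δ) := by positivity
    have hqq : 0 ≤ q ^ (2 + δ) := by positivity
    rcases le_or_gt q K with hqK | hqK
    · have : g (Y ω) = q := min_eq_left hqK
      rw [this]
      have := mul_nonneg hKδ.le (add_nonneg hpp hqq)
      linarith
    · have h3 : 1 ≤ K ^ (-δ) * q ^ δ := by
        rw [Real.rpow_neg hK.le, le_inv_mul_iff₀ (by positivity), mul_one]
        exact Real.rpow_le_rpow hK.le hqK.le hδ.le
      set M := max p q
      have hM0 : 0 < M := lt_max_of_lt_right (hK.trans hqK)
      have h4 : p * q * q ^ δ ≤ p ^ (2 + δ) + q ^ (2 + δ) := by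
        calc p * q * q ^ δ ≤ M * M * M ^ δ := by
              gcongr
              · exact le_max_left _ _
              · exact le_max_right _ _
              · exact le_max_right _ _
          _ = M ^ (2 + δ) := by
              rw [Real.rpow_add hM0, Real.rpow_two, pow_two]
          _ ≤ _ := by
              rcases max_choice p q with h | h <;> simp only [M, h] <;> linarith
      have h5 : 0 ≤ p * g (Y ω) := mul_nonneg hp (hg0 _)
      calc p * q ≤ p * q * (K ^ (-δ) * q ^ δ) := le_mul_of_one_le_right (by positivity) h3
        _ = K ^ (-δ) * (p * q * q ^ δ) := by ring
        _ ≤ K ^ (-δ) * (p ^ (2 + δ) + q ^ (2 + δ)) := by gcongr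
        _ ≤ _ := by linarith
  have hri : Integrable (fun ω => K ^ (-δ) * (f (X ω) ^ (2 + δ) + f (Y ω) ^ (2 + δ))) P :=
    (hXδ.add hYδ).const_mul _
  calc ∫ ω, f (X ω) * f (Y ω) ∂P
      ≤ ∫ ω, (f (X ω) * g (Y ω) + K ^ (-δ) * (f (X ω) ^ (2 + δ) + f (Y ω) ^ (2 + δ))) ∂P :=
        integral_mono_of_nonneg (ae_of_all _ fun ω => mul_nonneg (hf0 _) (hf0 _))
          (hfgi.add hri) (ae_of_all _ hpt)
    _ = ∫ ω, f (X ω) * g (Y ω) ∂P + K ^ (-δ) * (∫ ω, f (X ω) ^ (2 + δ) ∂P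
          + ∫ ω, f (Y ω) ^ (2 + δ) ∂P) := by
        rw [integral_add hfgi hri, integral_const_mul, integral_add hXδ hYδ]
    _ ≤ (m + a * K) * m + K ^ (-δ) * (A + A) := by gcongr
    _ = _ := by ring

/-- Strong law with rate, for a nonnegative function of a process with geometric `φ`-mixing
coefficients and constant one-dimensional distributions. -/
theorem ae_sum_le_rpow_of_phiMixing [IsProbabilityMeasure P] {z : ℕ → Ω → S}
    (hz : ∀ k, Measurable (z k)) {ν : Measure S}
    (hν : ∀ k, P.map (z k) = ν) {μ ρ : ℝ} (hμ : 0 < μ) (hρ0 : 0 < ρ) (hρ1 : ρ < 1)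
    (hmix : ∀ k, phiMixingCoeff P z k ≤ ENNReal.ofReal (μ * ρ ^ k))
    {f : S → ℝ} (hf : Measurable f) (hf0 : ∀ y, 0 ≤ f y) {δ : ℝ} (hδ0 : 0 < δ) (hδ1 : δ ≤ 1)
    (hfδ : Integrable (fun y => f y ^ (2 + δ)) ν) :
    ∀ᵐ ω ∂P, ∃ B : ℝ, 0 ≤ B ∧ ∀ n : ℕ, 1 ≤ n →
      |∑ k ∈ Finset.range n, (f (z k ω) - ∫ y, f y ∂ν)| ≤ B * (n : ℝ) ^ (7 / 8 : ℝ) := by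
  have hνp : IsProbabilityMeasure ν := hν 0 ▸ Measure.isProbabilityMeasure_map (hz 0).aemeasurable
  have hcomp : ∀ {g : S → ℝ}, Measurable g → ∀ k, ∫ ω, g (z k ω) ∂P = ∫ y, g y ∂ν := fun hg k => by
    rw [← hν k, integral_map (hz k).aemeasurable hg.aestronglyMeasurable]
  have hcompi : ∀ {g : S → ℝ}, Integrable g ν → ∀ k, Integrable (fun ω => g (z k ω)) P :=
    fun hg k => by
      rw [← hν k] at hg
      exact hg.comp_measurable (hz k)
  have hpow : ∀ p, 0 ≤ p → p ≤ 2 + δ → ∀ y, f y ^ p ≤ 1 + f y ^ (2 + δ) := fun p hp hp' y => by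
    have h0 : 0 ≤ f y ^ (2 + δ) := Real.rpow_nonneg (hf0 y) _
    rcases le_total (f y) 1 with h | h
    · linarith [Real.rpow_le_one (hf0 y) h hp]
    · linarith [Real.rpow_le_rpow_of_exponent_le h hp']
  have hfi : Integrable f ν := by
    refine ((integrable_const 1).add hfδ).mono' hf.aestronglyMeasurable (ae_of_all _ fun y => ?_)
    rw [Real.norm_of_nonneg (hf0 y)]
    simpa using hpow 1 (by norm_num) (by linarith) y
  have hf2i : Integrable (fun y => f y ^ 2) ν := by
    refine ((integrable_const 1).add hfδ).mono' (hf.pow_const 2).aestronglyMeasurable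
      (ae_of_all _ fun y => ?_)
    rw [Real.norm_of_nonneg (by positivity)]
    simpa using hpow 2 (by norm_num) (by linarith) y
  set m := ∫ y, f y ∂ν
  have hm0 : 0 ≤ m := integral_nonneg hf0
  set A := ∫ y, f y ^ (2 + δ) ∂ν
  have hA0 : 0 ≤ A := integral_nonneg fun y => Real.rpow_nonneg (hf0 y) _
  set V := ∫ y, f y ^ 2 ∂ν
  have hV0 : 0 ≤ V := integral_nonneg fun y => sq_nonneg _
  -- This rate balances the covariance inequality at level `K = ρ^(-k/2)`: the mixing term is of
  -- order `ρ^(k/2)`, at most `r^k` because `δ ≤ 1`, and the capping term `K^(-δ)` is exactly `r^k`.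
  set r := ρ ^ (δ / 2)
  have hr0 : 0 ≤ r := by positivity
  have hr1 : r < 1 := Real.rpow_lt_one hρ0.le hρ1 (by positivity)
  have hL : ∀ k, MemLp (fun ω => f (z k ω)) 2 P := fun k =>
    (memLp_two_iff_integrable_sq (hf.comp (hz k)).aestronglyMeasurable).2 (hcompi hf2i k)
  have hL' : ∀ k, MemLp (fun ω => f (z k ω) - m) 2 P := fun k => (hL k).sub (memLp_const m)
  have hexp : ∀ i j, ∫ ω, (f (z i ω) - m) * (f (z j ω) - m) ∂P =
      ∫ ω, f (z i ω) * f (z j ω) ∂P - m ^ 2 := by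
    intro i j
    have e1 : ∀ ω, (f (z i ω) - m) * (f (z j ω) - m) =
        f (z i ω) * f (z j ω) - (m * f (z i ω) + m * f (z j ω) - m ^ 2) := fun ω => by ring
    simp_rw [e1]
    have i1 : Integrable (fun ω => f (z i ω) * f (z j ω)) P := (hL i).integrable_mul (hL j)
    have i2 := (hcompi hfi i).const_mul m
    have i3 := (hcompi hfi j).const_mul m
    have i4 : Integrable (fun ω => m * f (z i ω) + m * f (z j ω)) P := i2.add i3
    have i5 : Integrable (fun ω => m * f (z i ω) + m * f (z j ω) - m ^ 2) P :=
      i4.sub (integrable_const _)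
    rw [integral_sub i1 i5, integral_sub i4 (integrable_const _),
      integral_add i2 i3, integral_const_mul, integral_const_mul, hcomp hf, hcomp hf]
    simp
    ring
  refine ae_sum_le_rpow_of_geometric_decay (C := V + μ * m + 2 * A) hL' hr0 hr1 (fun k => ?_) ?_
  · have h1 := hexp k k
    simp_rw [← pow_two] at h1
    rw [h1, hcomp (hf.pow_const 2) k]
    have := mul_nonneg hμ.le hm0
    nlinarith
  · intro i n hin
    obtain ⟨k, rfl⟩ : ∃ k, n = i + k := ⟨n - i, by omega⟩
    rw [hexp, Nat.add_sub_cancel_left]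
    have hK : 0 < ρ ^ (-(k : ℝ) / 2) := by positivity
    have h1 := integral_mul_le_of_measure_inter_le (hz i) (hz (i + k))
      (a := μ * ρ ^ k) (by positivity)
      (fun s t hs ht => measure_inter_le_of_phiMixing (by positivity) (hmix k) hs ht) hf hf0 hδ0
      (hcompi hfi i) (hcompi hfi (i + k)) (hcomp hf i) (hcomp hf (i + k)) (hcompi hfδ i)
      (hcompi hfδ (i + k)) (hcomp (hf.pow_const _) i).le (hcomp (hf.pow_const _) (i + k)).le hK
    have hrk : r ^ k = ρ ^ (δ / 2 * k) := by
      rw [← Real.rpow_natCast, ← Real.rpow_mul hρ0.le]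
    have h2 : μ * ρ ^ k * ρ ^ (-(k : ℝ) / 2) * m ≤ μ * m * r ^ k := by
      have : ρ ^ k * ρ ^ (-(k : ℝ) / 2) ≤ r ^ k := by
        rw [hrk, ← Real.rpow_natCast, ← Real.rpow_add hρ0]
        refine Real.rpow_le_rpow_of_exponent_ge hρ0 hρ1.le ?_
        have : (0 : ℝ) ≤ k := by positivity
        nlinarith
      calc _ = μ * m * (ρ ^ k * ρ ^ (-(k : ℝ) / 2)) := by ring
        _ ≤ _ := by gcongr
    have h3 : (ρ ^ (-(k : ℝ) / 2)) ^ (-δ) = r ^ k := by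
      rw [hrk, ← Real.rpow_mul hρ0.le]; congr 1; ring
    rw [h3] at h1
    have h4 : 0 ≤ V * r ^ k := by positivity
    linarith

end Mixing

/-! ### Convexity of the loss and the mean drift -/

section Loss

variable {Φ φ : ℝ → ℝ} {l : ℝ}

lemma LossAssumption.deriv_zero (hA : LossAssumption Φ φ l) : φ 0 = 0 := by
  have h : IsLocalMin Φ 0 := Filter.Eventually.of_forall fun t => by
    rcases eq_or_ne t 0 with rfl | ht
    · exact le_rfl
    · exact (hA.strict_min t ht).le
  exact h.hasDerivAt_eq_zero (hA.hasDeriv 0)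

lemma LossAssumption.deriv_mul_le (hA : LossAssumption Φ φ l) {s t : ℝ} (hst : s < t) :
    φ s * (t - s) ≤ Φ t - Φ s := by
  have h := hA.convex.le_slope_of_hasDerivAt (Set.mem_univ s) (Set.mem_univ t) hst (hA.hasDeriv s)
  rwa [slope_def_field, le_div_iff₀ (sub_pos.2 hst)] at h

lemma LossAssumption.le_deriv_mul (hA : LossAssumption Φ φ l) {s t : ℝ} (hst : s < t) :
    Φ t - Φ s ≤ φ t * (t - s) := by
  have h := hA.convex.slope_le_of_hasDerivAt (Set.mem_univ s) (Set.mem_univ t) hst (hA.hasDeriv t)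
  rwa [slope_def_field, div_le_iff₀ (sub_pos.2 hst)] at h

lemma LossAssumption.deriv_monotone (hA : LossAssumption Φ φ l) : Monotone φ := by
  intro s t hst
  rcases hst.eq_or_lt with rfl | hst
  · exact le_rfl
  · exact le_of_mul_le_mul_right ((hA.deriv_mul_le hst).trans (hA.le_deriv_mul hst))
      (sub_pos.2 hst)

lemma LossAssumption.deriv_pos (hA : LossAssumption Φ φ l) {t : ℝ} (ht : 0 < t) : 0 < φ t := by
  have h1 := hA.le_deriv_mul ht
  have h2 := hA.strict_min t ht.ne'
  rw [sub_zero] at h1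
  exact pos_of_mul_pos_left (by linarith) ht.le

lemma LossAssumption.deriv_neg (hA : LossAssumption Φ φ l) {t : ℝ} (ht : t < 0) : φ t < 0 := by
  have h1 := hA.deriv_mul_le ht
  have h2 := hA.strict_min t ht.ne
  by_contra! h
  nlinarith

/-- Convexity and `0 ≤ Φ` give `φ t ≤ Φ (t + 1) - Φ t ≤ Φ (t + 1)` for `t ≥ 0`, and symmetrically on
the left, so `φ` inherits the growth exponent of `Φ`. -/
lemma LossAssumption.exists_deriv_le (hA : LossAssumption Φ φ l) :
    ∃ C, 0 ≤ C ∧ ∀ t, |φ t| ≤ C * (1 + |t|) ^ l := by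
  obtain ⟨c, hc, hΦ, -⟩ := hA.growth
  have hb : ∀ t s, |s| = 1 + |t| → Φ s ≤ 2 * c * (1 + |t|) ^ l := by
    intro t s hs
    have h1 := (le_abs_self _).trans (hΦ s)
    rw [hs] at h1
    have h2 : 1 ≤ (1 + |t|) ^ l := Real.one_le_rpow (by linarith [abs_nonneg t]) hA.l_pos.le
    nlinarith
  refine ⟨2 * c, by positivity, fun t => ?_⟩
  rcases le_total 0 t with ht | ht
  · have h0 : 0 ≤ φ t := hA.deriv_zero ▸ hA.deriv_monotone ht
    rw [abs_of_nonneg h0]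
    have h1 := hA.deriv_mul_le (lt_add_one t)
    have h2 := hb t (t + 1) (by rw [abs_of_nonneg ht, abs_of_nonneg (by linarith)]; ring)
    have h3 := hA.nonneg t
    linarith
  · have h0 : φ t ≤ 0 := hA.deriv_zero ▸ hA.deriv_monotone ht
    rw [abs_of_nonpos h0]
    have h1 := hA.le_deriv_mul (sub_one_lt t)
    have h2 := hb t (t - 1) (by rw [abs_of_nonpos ht, abs_of_nonpos (by linarith)]; ring)
    have h3 := hA.nonneg t
    linarith

/-- The product form separates noise from regressor, so that independence can factor the moments. -/
lemma one_add_abs_sub_rpow_le (hl : 0 ≤ l) (s u : ℝ) :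
    (1 + |s - u|) ^ l ≤ (1 + |s|) ^ l * (1 + |u|) ^ l := by
  rw [← Real.mul_rpow (by positivity) (by positivity)]
  refine Real.rpow_le_rpow (by positivity) ?_ hl
  have := abs_sub s u
  nlinarith [abs_nonneg s, abs_nonneg u]

variable {μ : Measure ℝ}

lemma LossAssumption.integrable_deriv_sub (hA : LossAssumption Φ φ l)
    (hμ : Integrable (fun s => (1 + |s|) ^ l) μ) (u : ℝ) : Integrable (fun s => φ (s - u)) μ := by
  obtain ⟨C, hC, hφ⟩ := hA.exists_deriv_le
  refine (hμ.const_mul (C * (1 + |u|) ^ l)).mono'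
    (hA.deriv_continuous.comp (continuous_id.sub continuous_const)).aestronglyMeasurable
    (ae_of_all _ fun s => ?_)
  calc ‖φ (s - u)‖ ≤ C * (1 + |s - u|) ^ l := hφ _
    _ ≤ C * ((1 + |s|) ^ l * (1 + |u|) ^ l) := by
        gcongr; exact one_add_abs_sub_rpow_le hA.l_pos.le s u
    _ = _ := by ring

/-- The mean displacement of `φ` when its argument, distributed according to `μ`, is shifted by
`-u`. -/
noncomputable def meanDrift (φ : ℝ → ℝ) (μ : Measure ℝ) (u : ℝ) : ℝ := ∫ s, (φ (s - u) - φ s) ∂μ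

lemma LossAssumption.meanDrift_eq (hA : LossAssumption Φ φ l)
    (hμ : Integrable (fun s => (1 + |s|) ^ l) μ) (u : ℝ) :
    meanDrift φ μ u = ∫ s, φ (s - u) ∂μ - ∫ s, φ s ∂μ :=
  integral_sub (hA.integrable_deriv_sub hμ u) (by simpa using hA.integrable_deriv_sub hμ 0)

lemma LossAssumption.meanDrift_antitone (hA : LossAssumption Φ φ l)
    (hμ : Integrable (fun s => (1 + |s|) ^ l) μ) : Antitone (meanDrift φ μ) := by
  intro u v huv
  rw [hA.meanDrift_eq hμ, hA.meanDrift_eq hμ]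
  have := integral_mono (hA.integrable_deriv_sub hμ v) (hA.integrable_deriv_sub hμ u)
    fun s => hA.deriv_monotone (show s - v ≤ s - u by linarith)
  linarith

/-- Centring at `φ s` makes the drift vanish at the true parameter; the constant `∫ φ` left over is
later carried by the mean-zero regressors. -/
lemma meanDrift_zero : meanDrift φ μ 0 = 0 := by simp [meanDrift]

lemma LossAssumption.mul_meanDrift_nonpos (hA : LossAssumption Φ φ l)
    (hμ : Integrable (fun s => (1 + |s|) ^ l) μ) (u : ℝ) : u * meanDrift φ μ u ≤ 0 := by
  have h := hA.meanDrift_antitone hμ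
  have h0 : meanDrift φ μ 0 = 0 := meanDrift_zero
  rcases le_total 0 u with hu | hu
  · exact mul_nonpos_of_nonneg_of_nonpos hu (h0 ▸ h hu)
  · exact mul_nonpos_of_nonpos_of_nonneg hu (h0 ▸ h hu)

/-- The integrand has constant sign by monotonicity. It is nonzero for `s` strictly between 0 and
`u`, where `s` and `s - u` have opposite signs, and `μ` charges that interval. -/
lemma LossAssumption.meanDrift_ne_zero (hA : LossAssumption Φ φ l)
    (hμ : Integrable (fun s => (1 + |s|) ^ l) μ)
    (hpos : ∀ a, 0 < a → 0 < μ (Set.Ioo 0 a) ∧ 0 < μ (Set.Ioo (-a) 0)) {u : ℝ} (hu : u ≠ 0) :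
    meanDrift φ μ u ≠ 0 := by
  have hint₀ : Integrable φ μ := by simpa using hA.integrable_deriv_sub hμ 0
  have hint := hA.integrable_deriv_sub hμ u
  rcases hu.lt_or_gt with hu | hu
  · refine (LT.lt.ne' ?_)
    unfold meanDrift
    rw [integral_pos_iff_support_of_nonneg
      (fun s => sub_nonneg.2 (hA.deriv_monotone (by linarith))) (hint.sub hint₀)]
    refine (hpos (-u) (by linarith)).2.trans_le (measure_mono fun s hs => ?_)
    rw [neg_neg] at hs
    have h1 := hA.deriv_neg hs.2
    have h2 := hA.deriv_pos (sub_pos.2 hs.1)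
    exact (show (0 : ℝ) < φ (s - u) - φ s by linarith).ne'
  · refine (LT.lt.ne ?_)
    have h3 : 0 < ∫ s, (φ s - φ (s - u)) ∂μ := by
      rw [integral_pos_iff_support_of_nonneg
        (fun s => sub_nonneg.2 (hA.deriv_monotone (by linarith))) (hint₀.sub hint)]
      refine (hpos u hu).1.trans_le (measure_mono fun s hs => ?_)
      have h1 := hA.deriv_pos hs.1
      have h2 := hA.deriv_neg (sub_neg.2 hs.2)
      exact (show (0 : ℝ) < φ s - φ (s - u) by linarith).ne'
    have h4 : meanDrift φ μ u = -∫ s, (φ s - φ (s - u)) ∂μ := by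
      rw [← integral_neg]; simp [meanDrift]
    linarith

/-- By monotonicity the values at `a` and `-a` control the drift on all of `|u| ≥ a`. -/
lemma LossAssumption.exists_mul_meanDrift_le (hA : LossAssumption Φ φ l)
    (hμ : Integrable (fun s => (1 + |s|) ^ l) μ)
    (hpos : ∀ a, 0 < a → 0 < μ (Set.Ioo 0 a) ∧ 0 < μ (Set.Ioo (-a) 0)) {a : ℝ} (ha : 0 < a) :
    ∃ c, 0 < c ∧ ∀ u, a ≤ |u| → u * meanDrift φ μ u ≤ -c := by
  have h := hA.meanDrift_antitone hμ
  have h0 : meanDrift φ μ 0 = 0 := meanDrift_zero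
  have h1 : meanDrift φ μ a < 0 :=
    lt_of_le_of_ne (h0 ▸ h ha.le) (hA.meanDrift_ne_zero hμ hpos ha.ne')
  have h2 : 0 < meanDrift φ μ (-a) :=
    lt_of_le_of_ne (h0 ▸ h (by linarith : -a ≤ 0))
      (hA.meanDrift_ne_zero hμ hpos (by linarith : -a < 0).ne).symm
  refine ⟨a * min (-meanDrift φ μ a) (meanDrift φ μ (-a)),
    mul_pos ha (lt_min (by linarith) h2), fun u hu => ?_⟩
  have m1 := min_le_left (-meanDrift φ μ a) (meanDrift φ μ (-a))
  have m2 := min_le_right (-meanDrift φ μ a) (meanDrift φ μ (-a))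
  have m0 : 0 < min (-meanDrift φ μ a) (meanDrift φ μ (-a)) := lt_min (by linarith) h2
  rcases le_abs.1 hu with hu | hu
  · have := h hu
    nlinarith
  · have := h (show u ≤ -a by linarith)
    nlinarith

lemma LossAssumption.exists_abs_meanDrift_le (hA : LossAssumption Φ φ l)
    (hμ : Integrable (fun s => (1 + |s|) ^ l) μ) :
    ∃ C, 0 ≤ C ∧ ∀ u, |meanDrift φ μ u| ≤ C * (1 + |u|) ^ l := by
  obtain ⟨C, hC, hφ⟩ := hA.exists_deriv_le
  set I := ∫ s, (1 + |s|) ^ l ∂μ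
  have hI : 0 ≤ I := integral_nonneg fun s => by positivity
  have hb : ∀ u, |∫ s, φ (s - u) ∂μ| ≤ C * I * (1 + |u|) ^ l := by
    intro u
    refine (norm_integral_le_integral_norm (μ := μ) fun s => φ (s - u)).trans ?_
    calc ∫ s, ‖φ (s - u)‖ ∂μ ≤ ∫ s, C * (1 + |u|) ^ l * (1 + |s|) ^ l ∂μ := by
          refine integral_mono (hA.integrable_deriv_sub hμ u).norm (hμ.const_mul _) fun s => ?_
          calc ‖φ (s - u)‖ ≤ C * (1 + |s - u|) ^ l := hφ _
            _ ≤ C * ((1 + |s|) ^ l * (1 + |u|) ^ l) := by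
                gcongr; exact one_add_abs_sub_rpow_le hA.l_pos.le s u
            _ = _ := by ring
      _ = _ := by rw [integral_const_mul]; ring
  refine ⟨2 * (C * I), by positivity, fun u => ?_⟩
  have h0 := hb 0
  simp only [sub_zero, abs_zero, add_zero, Real.one_rpow, mul_one] at h0
  have h1 := hb u
  have h2 : 1 ≤ (1 + |u|) ^ l := Real.one_le_rpow (by linarith [abs_nonneg u]) hA.l_pos.le
  have h3 : C * I ≤ C * I * (1 + |u|) ^ l := le_mul_of_one_le_right (by positivity) h2
  rw [hA.meanDrift_eq hμ]
  refine (abs_sub _ _).trans ?_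
  linarith

end Loss

/-! ### Adapted trajectories with deterministic start -/

section Trajectory

variable {d : ℕ}

/-- One step of the algorithm with expanding truncations, from the state `(θ, σ)` at time `k`. -/
noncomputable def truncStep (φ : ℝ → ℝ) (l : ℝ) (θs : EuclideanSpace ℝ (Fin d)) (k : ℕ)
    (p : (EuclideanSpace ℝ (Fin d) × ℕ) × EuclideanSpace ℝ (Fin d) × ℝ) :
    EuclideanSpace ℝ (Fin d) × ℕ :=
  -- The residual `y - ⟨θ, x⟩` is expressed through the noise, as `w - ⟨θ - θs, x⟩`.
  let c := p.1.1 + (1 / (k : ℝ)) • φ (p.2.2 - inner ℝ (p.1.1 - θs) p.2.1) • p.2.1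
  (if ‖c‖ ≤ truncBound l p.1.2 then c else 0,
    p.1.2 + if truncBound l p.1.2 < ‖c‖ then 1 else 0)

/-- The trajectory of the algorithm started at time `k₀` from the state `(0, s)`. -/
noncomputable def traj (φ : ℝ → ℝ) (l : ℝ) (θs : EuclideanSpace ℝ (Fin d)) (k₀ s : ℕ)
    (x : ℕ → EuclideanSpace ℝ (Fin d)) (w : ℕ → ℝ) : ℕ → EuclideanSpace ℝ (Fin d) × ℕ
  | 0 => (0, s)
  | k + 1 => if k₀ ≤ k then truncStep φ l θs k (traj φ l θs k₀ s x w k, x k, w (k + 1)) else (0, s)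

lemma measurable_truncStep {φ : ℝ → ℝ} (hφ : Continuous φ) (l : ℝ)
    (θs : EuclideanSpace ℝ (Fin d)) (k : ℕ) : Measurable (truncStep φ l θs k) := by
  have hc : Measurable fun p : (EuclideanSpace ℝ (Fin d) × ℕ) × EuclideanSpace ℝ (Fin d) × ℝ =>
      p.1.1 + (1 / (k : ℝ)) • φ (p.2.2 - inner ℝ (p.1.1 - θs) p.2.1) • p.2.1 := by
    have := hφ.measurable
    fun_prop
  have hM : Measurable fun p : (EuclideanSpace ℝ (Fin d) × ℕ) × EuclideanSpace ℝ (Fin d) × ℝ =>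
      truncBound l p.1.2 :=
    (Measurable.of_discrete (f := truncBound l)).comp (measurable_snd.comp measurable_fst)
  refine Measurable.prodMk (Measurable.ite (measurableSet_le hc.norm hM) hc measurable_const) ?_
  exact (measurable_snd.comp measurable_fst).add
    (Measurable.ite (measurableSet_lt hM hc.norm) measurable_const measurable_const)

variable {Ω : Type*}

/-- The data `(x 0, …, x k, w 1, …, w k)` available at time `k`. -/
def pastData (x : ℕ → Ω → EuclideanSpace ℝ (Fin d)) (w : ℕ → Ω → ℝ) (k : ℕ) (ω : Ω) :
    (Fin (k + 1) → EuclideanSpace ℝ (Fin d)) × (Fin k → ℝ) :=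
  ((fun i : Fin (k + 1) => x i ω), (fun j : Fin k => w (j + 1) ω))

lemma measurable_comap_pastData_regressor (x : ℕ → Ω → EuclideanSpace ℝ (Fin d)) (w : ℕ → Ω → ℝ)
    {i k : ℕ} (h : i ≤ k) :
    Measurable[MeasurableSpace.comap (pastData x w k) inferInstance] (x i) :=
  ((measurable_pi_apply (⟨i, by omega⟩ : Fin (k + 1))).comp measurable_fst).comp
    (comap_measurable (pastData x w k))

lemma measurable_comap_pastData_noise (x : ℕ → Ω → EuclideanSpace ℝ (Fin d)) (w : ℕ → Ω → ℝ)
    {i k : ℕ} (h : i < k) :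
    Measurable[MeasurableSpace.comap (pastData x w k) inferInstance] (w (i + 1)) :=
  ((measurable_pi_apply (⟨i, h⟩ : Fin k)).comp measurable_snd).comp
    (comap_measurable (pastData x w k))

/-- Adaptedness relies on the deterministic start: the state at time `i` then involves only
regressors before `i` and noise up to `i`. -/
lemma measurable_comap_pastData_traj {φ : ℝ → ℝ} (hφ : Continuous φ) (l : ℝ)
    (θs : EuclideanSpace ℝ (Fin d)) (k₀ s : ℕ)
    (x : ℕ → Ω → EuclideanSpace ℝ (Fin d)) (w : ℕ → Ω → ℝ) {i k : ℕ} (h : i ≤ k) :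
    Measurable[MeasurableSpace.comap (pastData x w k) inferInstance]
      (fun ω => traj φ l θs k₀ s (fun k => x k ω) (fun k => w k ω) i) := by
  induction i with
  | zero => exact measurable_const
  | succ i ih =>
    simp only [traj]
    split_ifs with hi
    · exact (measurable_truncStep hφ l θs i).comp ((ih (by omega)).prodMk
        ((measurable_comap_pastData_regressor x w (by omega)).prodMk
          (measurable_comap_pastData_noise x w (by omega))))
    · exact measurable_const

/-- The martingale-difference property without conditional expectations: under independence the
joint law is a product, and Fubini integrates out `W` first. -/
lemma integral_eq_zero_of_indepFun [MeasurableSpace Ω] {T : Type*} [MeasurableSpace T] {P : Measure Ω}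
    [IsProbabilityMeasure P] {V : Ω → T} {W : Ω → ℝ} (hV : Measurable V) (hW : Measurable W)
    (hind : IndepFun V W P) {g : T × ℝ → ℝ} (hg : Measurable g)
    (hi : Integrable (fun ω => g (V ω, W ω)) P) (h0 : ∀ v, ∫ s, g (v, s) ∂(P.map W) = 0) :
    ∫ ω, g (V ω, W ω) ∂P = 0 := by
  have hmap := (indepFun_iff_map_prod_eq_prod_map_map hV.aemeasurable hW.aemeasurable).1 hind
  have : IsProbabilityMeasure (P.map V) := Measure.isProbabilityMeasure_map hV.aemeasurable
  have : IsProbabilityMeasure (P.map W) := Measure.isProbabilityMeasure_map hW.aemeasurable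
  have hi' : Integrable g ((P.map V).prod (P.map W)) := by
    rw [← hmap]
    exact (integrable_map_measure hg.aestronglyMeasurable
      (hV.prodMk hW).aemeasurable).2 hi
  rw [← integral_map (f := g) (hV.prodMk hW).aemeasurable hg.aestronglyMeasurable, hmap,
    integral_prod _ hi']
  simp [h0]

end Trajectory

/-! ### The centred observation noise -/

section Noise

variable {d : ℕ}

open Classical in
/-- The centred observation noise at the estimate `θ`, cut off outside the ball of radius `R`. -/
noncomputable def centredNoise (φ : ℝ → ℝ) (μ : Measure ℝ) (θs : EuclideanSpace ℝ (Fin d)) (R : ℝ)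
    (p : (EuclideanSpace ℝ (Fin d) × EuclideanSpace ℝ (Fin d)) × ℝ) : ℝ :=
  if ‖p.1.1‖ ≤ R then
    φ (p.2 - inner ℝ (p.1.1 - θs) p.1.2) - ∫ s, φ (s - inner ℝ (p.1.1 - θs) p.1.2) ∂μ
  else 0

variable {Φ φ : ℝ → ℝ} {l : ℝ} {μ : Measure ℝ}

lemma LossAssumption.measurable_centredNoise (hA : LossAssumption Φ φ l)
    (hμ : Integrable (fun s => (1 + |s|) ^ l) μ) (θs : EuclideanSpace ℝ (Fin d)) (R : ℝ) :
    Measurable (centredNoise φ μ θs R) := by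
  -- Up to a constant this is the mean drift, which is monotone and hence measurable.
  have h1 : Measurable fun u => ∫ s, φ (s - u) ∂μ := by
    have h2 : (fun u => ∫ s, φ (s - u) ∂μ) = fun u => meanDrift φ μ u + ∫ s, φ s ∂μ := by
      ext u; rw [hA.meanDrift_eq hμ]; ring
    rw [h2]
    exact (hA.meanDrift_antitone hμ).measurable.add_const _
  have hu : Measurable fun p : (EuclideanSpace ℝ (Fin d) × EuclideanSpace ℝ (Fin d)) × ℝ =>
      inner ℝ (p.1.1 - θs) p.1.2 := by fun_prop
  refine Measurable.ite (measurableSet_le (by fun_prop) measurable_const) ?_ measurable_const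
  exact (hA.deriv_continuous.measurable.comp (measurable_snd.sub hu)).sub (h1.comp hu)

lemma LossAssumption.integral_centredNoise [IsProbabilityMeasure μ] (hA : LossAssumption Φ φ l)
    (hμ : Integrable (fun s => (1 + |s|) ^ l) μ) (θs : EuclideanSpace ℝ (Fin d)) (R : ℝ)
    (v : EuclideanSpace ℝ (Fin d) × EuclideanSpace ℝ (Fin d)) :
    ∫ s, centredNoise φ μ θs R (v, s) ∂μ = 0 := by
  unfold centredNoise
  by_cases h : ‖v.1‖ ≤ R
  · simp only [h, if_true]
    rw [integral_sub (hA.integrable_deriv_sub hμ _) (integrable_const _)]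
    simp
  · simp [h]

lemma one_add_abs_inner_le {v x : EuclideanSpace ℝ (Fin d)} {R : ℝ} (hR : 0 ≤ R) (hv : ‖v‖ ≤ R) :
    1 + |inner ℝ v x| ≤ (1 + R) * (1 + ‖x‖) := by
  have h1 := abs_real_inner_le_norm v x
  have h2 : ‖v‖ * ‖x‖ ≤ R * ‖x‖ := by gcongr
  nlinarith [norm_nonneg x]

lemma rpow_one_add_abs_inner_mul_le (hl : 0 ≤ l) {v x : EuclideanSpace ℝ (Fin d)} {R : ℝ}
    (hR : 0 ≤ R) (hv : ‖v‖ ≤ R) :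
    (1 + |inner ℝ v x|) ^ l * ‖x‖ ≤ (1 + R) ^ l * (1 + ‖x‖) ^ (l + 1) := by
  have h1 : (1 + |inner ℝ v x|) ^ l ≤ ((1 + R) * (1 + ‖x‖)) ^ l :=
    Real.rpow_le_rpow (by positivity) (one_add_abs_inner_le hR hv) hl
  rw [Real.mul_rpow (by positivity) (by positivity)] at h1
  have h2 : (0 : ℝ) < 1 + ‖x‖ := by positivity
  rw [Real.rpow_add_one h2.ne', ← mul_assoc]
  gcongr
  linarith

/-- On the ball kept by the cutoff, `|⟨θ - θs, x⟩|` is at most a constant times `‖x‖`; the growth of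
`φ` gives the power `l`, and the factor `‖x‖` one more. The cutoff thus makes the noise square
integrable whatever the trajectory does. -/
lemma LossAssumption.exists_abs_centredNoise_mul_le (hA : LossAssumption Φ φ l)
    (hμ : Integrable (fun s => (1 + |s|) ^ l) μ) (θs : EuclideanSpace ℝ (Fin d)) {R : ℝ}
    (hR : 0 ≤ R) :
    ∃ C, 0 ≤ C ∧ ∀ θ x s, |centredNoise φ μ θs R ((θ, x), s)| * ‖x‖ ≤
      C * ((1 + ‖x‖) ^ (l + 1) * (1 + |s|) ^ l) := by
  obtain ⟨C, hC, hφ⟩ := hA.exists_deriv_le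
  obtain ⟨C', hC', hh⟩ := hA.exists_abs_meanDrift_le hμ
  set b := |∫ s, φ s ∂μ|
  have hb : 0 ≤ b := abs_nonneg _
  refine ⟨(C + C' + b) * (1 + (R + ‖θs‖)) ^ l, by positivity, fun θ x s => ?_⟩
  unfold centredNoise
  by_cases h : ‖θ‖ ≤ R
  · simp only [h, if_true]
    set u := inner ℝ (θ - θs) x
    have hu := rpow_one_add_abs_inner_mul_le hA.l_pos.le (x := x) (by positivity : 0 ≤ R + ‖θs‖)
      ((norm_sub_le θ θs).trans (by linarith))
    have hs1 : 1 ≤ (1 + |s|) ^ l := Real.one_le_rpow (by linarith [abs_nonneg s]) hA.l_pos.le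
    have hu1 : 1 ≤ (1 + |u|) ^ l := Real.one_le_rpow (by linarith [abs_nonneg u]) hA.l_pos.le
    have h1 : |φ (s - u)| ≤ C * ((1 + |s|) ^ l * (1 + |u|) ^ l) :=
      (hφ _).trans (by gcongr; exact one_add_abs_sub_rpow_le hA.l_pos.le s u)
    have h2 : |∫ t, φ (t - u) ∂μ| ≤ (C' + b) * ((1 + |s|) ^ l * (1 + |u|) ^ l) := by
      have h3 : ∫ t, φ (t - u) ∂μ = meanDrift φ μ u + ∫ t, φ t ∂μ := by
        rw [hA.meanDrift_eq hμ]; ring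
      rw [h3]
      refine (abs_add_le _ _).trans ?_
      calc |meanDrift φ μ u| + b ≤ C' * (1 + |u|) ^ l + b * (1 + |u|) ^ l :=
            add_le_add (hh u) (le_mul_of_one_le_right hb hu1)
        _ = (C' + b) * (1 * (1 + |u|) ^ l) := by ring
        _ ≤ _ := by gcongr
    calc |φ (s - u) - ∫ t, φ (t - u) ∂μ| * ‖x‖
        ≤ ((C + C' + b) * ((1 + |s|) ^ l * (1 + |u|) ^ l)) * ‖x‖ := by
          gcongr
          refine (abs_sub _ _).trans ?_
          linarith
      _ = (C + C' + b) * (1 + |s|) ^ l * ((1 + |u|) ^ l * ‖x‖) := by ring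
      _ ≤ (C + C' + b) * (1 + |s|) ^ l * ((1 + (R + ‖θs‖)) ^ l * (1 + ‖x‖) ^ (l + 1)) := by gcongr
      _ = _ := by ring
  · simp only [h, if_false, abs_zero, zero_mul]
    positivity

end Noise

/-! ### Auxiliary moment and norm estimates -/

section Moments

lemma integrable_one_add_rpow {T : Type*} [MeasurableSpace T] {ν : Measure T} [IsFiniteMeasure ν]
    {t : T → ℝ} (ht : Measurable t) (ht0 : ∀ y, 0 ≤ t y) {p q : ℝ} (hq : 0 ≤ q) (hqp : q ≤ p)
    (hi : Integrable (fun y => t y ^ p) ν) : Integrable (fun y => (1 + t y) ^ q) ν := by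
  refine (((integrable_const 1).add hi).const_mul (2 ^ p)).mono'
    ((measurable_const.add ht).pow_const q).aestronglyMeasurable (ae_of_all _ fun y => ?_)
  have h0 := ht0 y
  rw [Real.norm_of_nonneg (by positivity)]
  have hp : 0 ≤ p := hq.trans hqp
  calc (1 + t y) ^ q ≤ (1 + t y) ^ p :=
        Real.rpow_le_rpow_of_exponent_le (by linarith) hqp
    _ ≤ (2 * max 1 (t y)) ^ p := by
        refine Real.rpow_le_rpow (by positivity) ?_ hp
        linarith [le_max_left 1 (t y), le_max_right 1 (t y)]
    _ = 2 ^ p * max 1 (t y) ^ p := Real.mul_rpow (by norm_num) (by positivity)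
    _ ≤ 2 ^ p * (1 + t y ^ p) := by
        gcongr
        have h1 : 0 ≤ t y ^ p := by positivity
        rcases max_choice 1 (t y) with h | h <;> rw [h]
        · rw [Real.one_rpow]; linarith
        · linarith

lemma measure_pos_of_density_pos {T : Type*} [MeasurableSpace T] {ν m : Measure T} {q : T → ℝ}
    (hq : Measurable q) (hν : ν = m.withDensity fun u => ENNReal.ofReal (q u)) {s t : Set T}
    (hst : s ⊆ t) (hs : 0 < m s) (hpos : ∀ u ∈ s, 0 < q u) : 0 < ν t := by
  refine lt_of_lt_of_le ?_ (measure_mono hst)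
  rw [pos_iff_ne_zero, hν, Ne, withDensity_apply_eq_zero hq.ennreal_ofReal]
  refine ne_of_gt (hs.trans_le (measure_mono fun u hu => ⟨?_, hu⟩))
  simpa using hpos u hu

lemma euclidean_norm_le_sum_abs {d : ℕ} (v : EuclideanSpace ℝ (Fin d)) : ‖v‖ ≤ ∑ a, |v a| := by
  have h := (EuclideanSpace.basisFun (Fin d) ℝ).sum_repr v
  calc ‖v‖ = ‖∑ a, v a • EuclideanSpace.basisFun (Fin d) ℝ a‖ := by
        conv_lhs => rw [← h]
        simp
    _ ≤ ∑ a, ‖v a • EuclideanSpace.basisFun (Fin d) ℝ a‖ := norm_sum_le _ _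
    _ = ∑ a, |v a| := by simp [norm_smul]

lemma exists_norm_le_rpow_of_coord {d : ℕ} {S : ℕ → EuclideanSpace ℝ (Fin d)}
    (h : ∀ a, ∃ B : ℝ, 0 ≤ B ∧ ∀ n : ℕ, 1 ≤ n → |S n a| ≤ B * (n : ℝ) ^ (7 / 8 : ℝ)) :
    ∃ B : ℝ, 0 ≤ B ∧ ∀ n : ℕ, 1 ≤ n → ‖S n‖ ≤ B * (n : ℝ) ^ (7 / 8 : ℝ) := by
  choose B hB0 hB using h
  refine ⟨∑ a, B a, Finset.sum_nonneg fun a _ => hB0 a, fun n hn => ?_⟩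
  rw [Finset.sum_mul]
  exact (euclidean_norm_le_sum_abs _).trans (Finset.sum_le_sum fun a _ => hB a n hn)

lemma abs_coord_le_norm {d : ℕ} (v : EuclideanSpace ℝ (Fin d)) (a : Fin d) : |v a| ≤ ‖v‖ :=
  PiLp.norm_apply_le v a

end Moments

/-! ### Almost sure bounds for the accumulated noise and the regressors -/

section DataProperties

variable {Ω : Type*} [MeasurableSpace Ω] {P : Measure Ω} [IsProbabilityMeasure P] {d : ℕ}
  {x : ℕ → Ω → EuclideanSpace ℝ (Fin d)} {w : ℕ → Ω → ℝ} {Φ φ : ℝ → ℝ} {l : ℝ}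
  {μ : Measure ℝ} {ν : Measure (EuclideanSpace ℝ (Fin d))}

/-- Along a trajectory the accumulated centred noise is almost surely `O(n ^ (7 / 8))`. -/
lemma ae_sum_centredNoise_le (hA : LossAssumption Φ φ l) (hx : ∀ k, Measurable (x k))
    (hw : ∀ k, Measurable (w (k + 1))) (hν : ∀ k, P.map (x k) = ν)
    (hμ : ∀ k, P.map (w (k + 1)) = μ)
    (hνi : Integrable (fun y => ((1 + ‖y‖) ^ (l + 1)) ^ 2) ν)
    (hμi : Integrable (fun s => ((1 + |s|) ^ l) ^ 2) μ)
    (hμi' : Integrable (fun s => (1 + |s|) ^ l) μ)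
    (hind : ∀ k, IndepFun (w (k + 1)) (pastData x w k) P)
    (θs : EuclideanSpace ℝ (Fin d)) (k₀ s R : ℕ) (a : Fin d) :
    ∀ᵐ ω ∂P, ∃ B : ℝ, 0 ≤ B ∧ ∀ n : ℕ, 1 ≤ n →
      |∑ k ∈ Finset.range n, centredNoise φ μ θs R
        (((traj φ l θs k₀ s (fun k => x k ω) (fun k => w k ω) k).1, x k ω), w (k + 1) ω)
        * x k ω a| ≤ B * (n : ℝ) ^ (7 / 8 : ℝ) := by
  have hμp : IsProbabilityMeasure μ :=
    hμ 0 ▸ Measure.isProbabilityMeasure_map (hw 0).aemeasurable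
  set θ : ℕ → Ω → EuclideanSpace ℝ (Fin d) := fun k ω =>
    (traj φ l θs k₀ s (fun k => x k ω) (fun k => w k ω) k).1 with hθ
  set X : ℕ → Ω → ℝ := fun k ω =>
    centredNoise φ μ θs R ((θ k ω, x k ω), w (k + 1) ω) * x k ω a with hX
  have hNm := hA.measurable_centredNoise hμi' θs R
  have hcoord : Measurable fun y : EuclideanSpace ℝ (Fin d) => y a := by fun_prop
  have hpast : ∀ k, MeasurableSpace.comap (pastData x w k) inferInstance ≤ ‹MeasurableSpace Ω› := by
    intro k
    have : Measurable (pastData x w k) :=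
      (measurable_pi_lambda _ fun i : Fin (k + 1) => hx i).prodMk
        (measurable_pi_lambda _ fun j : Fin k => hw j)
    exact this.comap_le
  have hθF : ∀ {i k}, i ≤ k →
      Measurable[MeasurableSpace.comap (pastData x w k) inferInstance] (θ i) := fun h =>
    measurable_fst.comp (measurable_comap_pastData_traj hA.deriv_continuous l θs k₀ s x w h)
  have hXF : ∀ {i k}, i < k →
      Measurable[MeasurableSpace.comap (pastData x w k) inferInstance] (X i) := fun {i k} h =>
    (hNm.comp (((hθF h.le).prodMk (measurable_comap_pastData_regressor x w h.le)).prodMk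
      (measurable_comap_pastData_noise x w h))).mul
      (hcoord.comp (measurable_comap_pastData_regressor x w h.le))
  have hXm : ∀ k, Measurable (X k) := fun k => (hXF (Nat.lt_succ_self k)).mono (hpast _) le_rfl
  have hindV : ∀ {T : Type} [MeasurableSpace T] {V : Ω → T} (k : ℕ),
      Measurable[MeasurableSpace.comap (pastData x w k) inferInstance] V →
      IndepFun V (w (k + 1)) P := fun k hV => by
    have h1 := (IndepFun_iff_Indep _ _ _).1 (hind k)
    exact ((IndepFun_iff_Indep _ _ _).2 (indep_of_indep_of_le_right h1 hV.comap_le)).symm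
  obtain ⟨C, hC, hb⟩ := hA.exists_abs_centredNoise_mul_le hμi' θs (R := R) (by positivity)
  have hXb : ∀ k ω, |X k ω| ≤ C * ((1 + ‖x k ω‖) ^ (l + 1) * (1 + |w (k + 1) ω|) ^ l) := by
    intro k ω
    simp only [hX]
    rw [abs_mul]
    refine le_trans ?_ (hb (θ k ω) (x k ω) (w (k + 1) ω))
    gcongr
    exact abs_coord_le_norm _ _
  have hXsq : ∀ k ω, X k ω ^ 2 ≤
      C ^ 2 * (((1 + ‖x k ω‖) ^ (l + 1)) ^ 2 * ((1 + |w (k + 1) ω|) ^ l) ^ 2) := by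
    intro k ω
    rw [← sq_abs]
    calc |X k ω| ^ 2 ≤ (C * ((1 + ‖x k ω‖) ^ (l + 1) * (1 + |w (k + 1) ω|) ^ l)) ^ 2 := by
          gcongr; exact hXb k ω
      _ = _ := by ring
  have he1 : Measurable fun y : EuclideanSpace ℝ (Fin d) => ((1 + ‖y‖) ^ (l + 1)) ^ 2 := by fun_prop
  have he2 : Measurable fun s : ℝ => ((1 + |s|) ^ l) ^ 2 := by fun_prop
  have hi1 : ∀ k, Integrable (fun ω => ((1 + ‖x k ω‖) ^ (l + 1)) ^ 2) P := fun k => by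
    rw [← hν k] at hνi; exact hνi.comp_measurable (hx k)
  have hi2 : ∀ k, Integrable (fun ω => ((1 + |w (k + 1) ω|) ^ l) ^ 2) P := fun k => by
    rw [← hμ k] at hμi; exact hμi.comp_measurable (hw k)
  have hindxw : ∀ k, IndepFun (fun ω => ((1 + ‖x k ω‖) ^ (l + 1)) ^ 2)
      (fun ω => ((1 + |w (k + 1) ω|) ^ l) ^ 2) P := fun k =>
    (hindV k (measurable_comap_pastData_regressor x w le_rfl)).comp he1 he2
  have hi12 : ∀ k, Integrable (fun ω => ((1 + ‖x k ω‖) ^ (l + 1)) ^ 2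
      * ((1 + |w (k + 1) ω|) ^ l) ^ 2) P := fun k =>
    (hindxw k).integrable_mul (hi1 k) (hi2 k)
  have hXL : ∀ k, MemLp (X k) 2 P := fun k => by
    rw [memLp_two_iff_integrable_sq (hXm k).aestronglyMeasurable]
    refine ((hi12 k).const_mul (C ^ 2)).mono' ((hXm k).pow_const 2).aestronglyMeasurable
      (ae_of_all _ fun ω => ?_)
    rw [Real.norm_of_nonneg (sq_nonneg _)]
    exact hXsq k ω
  -- The terms are orthogonal, so rate 0 is allowed: `0 ^ (n - i) = 0` for `i < n`.
  refine ae_sum_le_rpow_of_geometric_decay (r := 0)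
    (C := C ^ 2 * ((∫ y, ((1 + ‖y‖) ^ (l + 1)) ^ 2 ∂ν) * ∫ s, ((1 + |s|) ^ l) ^ 2 ∂μ)) hXL le_rfl
    zero_lt_one (fun k => ?_) fun i n hin => ?_
  · calc ∫ ω, X k ω ^ 2 ∂P ≤ ∫ ω, C ^ 2 * (((1 + ‖x k ω‖) ^ (l + 1)) ^ 2
          * ((1 + |w (k + 1) ω|) ^ l) ^ 2) ∂P :=
          integral_mono (hXL k).integrable_sq ((hi12 k).const_mul _) (hXsq k)
      _ = _ := by
          rw [integral_const_mul, (hindxw k).integral_fun_mul_eq_mul_integral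
            (hi1 k).1 (hi2 k).1, ← hν k, ← hμ k,
            integral_map (hx k).aemeasurable he1.aestronglyMeasurable,
            integral_map (hw k).aemeasurable he2.aestronglyMeasurable]
  · rw [zero_pow (by omega), mul_zero]
    refine le_of_eq ?_
    -- `V` collects all of the product `X i * X n` that is known at time `n`; only `w (n + 1)`
    -- remains, over which the centred noise integrates to 0.
    set V : Ω → (EuclideanSpace ℝ (Fin d) × EuclideanSpace ℝ (Fin d)) × ℝ :=
      fun ω => ((θ n ω, x n ω), X i ω)
    have hVF : Measurable[MeasurableSpace.comap (pastData x w n) inferInstance] V :=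
      ((hθF le_rfl).prodMk (measurable_comap_pastData_regressor x w le_rfl)).prodMk (hXF hin)
    have hg : Measurable fun p : ((EuclideanSpace ℝ (Fin d) × EuclideanSpace ℝ (Fin d)) × ℝ) × ℝ =>
        p.1.2 * (centredNoise φ μ θs R (p.1.1, p.2) * p.1.1.2 a) := by
      have h1 : Measurable fun p : ((EuclideanSpace ℝ (Fin d) × EuclideanSpace ℝ (Fin d)) × ℝ) × ℝ =>
          centredNoise φ μ θs R (p.1.1, p.2) :=
        hNm.comp ((measurable_fst.comp measurable_fst).prodMk measurable_snd)
      fun_prop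
    refine integral_eq_zero_of_indepFun (hVF.mono (hpast n) le_rfl) (hw n) (hindV n hVF) hg
      ((hXL i).integrable_mul (hXL n)) fun v => ?_
    simp only
    rw [integral_const_mul, integral_mul_const, hμ n, hA.integral_centredNoise hμi' θs R v.1,
      zero_mul, mul_zero]

/-- Partial sums of the regressors are almost surely `O(n ^ (7 / 8))`. -/
lemma ae_sum_regressor_le (hx : ∀ k, Measurable (x k)) (hν : ∀ k, P.map (x k) = ν)
    {c ρ δ : ℝ} (hc : 0 < c) (hρ0 : 0 < ρ) (hρ1 : ρ < 1) (hδ0 : 0 < δ) (hδ1 : δ ≤ 1)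
    (hmix : ∀ k, phiMixingCoeff P x k ≤ ENNReal.ofReal (c * ρ ^ k))
    (hνi : Integrable (fun y => (1 + ‖y‖) ^ (2 + δ)) ν) (hmean : ∫ ω, x 0 ω ∂P = 0) (a : Fin d) :
    ∀ᵐ ω ∂P, ∃ B : ℝ, 0 ≤ B ∧ ∀ n : ℕ, 1 ≤ n →
      |∑ k ∈ Finset.range n, x k ω a| ≤ B * (n : ℝ) ^ (7 / 8 : ℝ) := by
  have hνp : IsProbabilityMeasure ν := hν 0 ▸ Measure.isProbabilityMeasure_map (hx 0).aemeasurable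
  have hcoord : Measurable fun y : EuclideanSpace ℝ (Fin d) => y a := by fun_prop
  -- The strong law above is for nonnegative functions, so the coordinate is split into positive and
  -- negative part (`ε = 1` and `ε = -1`); their means cancel because the regressors are centred.
  have hpart : ∀ ε : ℝ, |ε| = 1 → Measurable (fun y : EuclideanSpace ℝ (Fin d) => max (ε * y a) 0) ∧
      (∀ y : EuclideanSpace ℝ (Fin d), max (ε * y a) 0 ≤ 1 + ‖y‖) := by
    intro ε hε
    refine ⟨by fun_prop, fun y => max_le ?_ (by positivity)⟩
    have h1 : ε * y a ≤ |ε * y a| := le_abs_self _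
    rw [abs_mul, hε, one_mul] at h1
    linarith [abs_coord_le_norm y a]
  have hInt1 : Integrable (fun y : EuclideanSpace ℝ (Fin d) => 1 + ‖y‖) ν := by
    refine hνi.mono' (by fun_prop) (ae_of_all _ fun y => ?_)
    rw [Real.norm_of_nonneg (by positivity)]
    calc 1 + ‖y‖ = (1 + ‖y‖) ^ (1 : ℝ) := (Real.rpow_one _).symm
      _ ≤ _ := Real.rpow_le_rpow_of_exponent_le (by linarith [norm_nonneg y]) (by linarith)
  have hpi : ∀ ε : ℝ, |ε| = 1 →
      Integrable (fun y : EuclideanSpace ℝ (Fin d) => max (ε * y a) 0) ν := fun ε hε =>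
    hInt1.mono' (hpart ε hε).1.aestronglyMeasurable (ae_of_all _ fun y => by
      rw [Real.norm_of_nonneg (le_max_right _ _)]; exact (hpart ε hε).2 y)
  have hbound : ∀ ε : ℝ, |ε| = 1 → ∀ᵐ ω ∂P, ∃ B : ℝ, 0 ≤ B ∧ ∀ n : ℕ, 1 ≤ n →
      |∑ k ∈ Finset.range n, (max (ε * x k ω a) 0 - ∫ y, max (ε * y a) 0 ∂ν)| ≤
        B * (n : ℝ) ^ (7 / 8 : ℝ) := by
    intro ε hε
    refine ae_sum_le_rpow_of_phiMixing hx hν hc hρ0 hρ1 hmix (hpart ε hε).1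
      (fun y => le_max_right _ _) hδ0 hδ1 ?_
    refine hνi.mono' ((hpart ε hε).1.pow_const _).aestronglyMeasurable (ae_of_all _ fun y => ?_)
    rw [Real.norm_of_nonneg (Real.rpow_nonneg (le_max_right _ _) _)]
    exact Real.rpow_le_rpow (le_max_right _ _) ((hpart ε hε).2 y) (by linarith)
  have hmean' : ∫ y, max (1 * y a) 0 ∂ν - ∫ y, max (-1 * y a) 0 ∂ν = 0 := by
    rw [← integral_sub (hpi 1 (by simp)) (hpi (-1) (by simp))]
    have h1 : ∀ y : EuclideanSpace ℝ (Fin d), max (1 * y a) 0 - max (-1 * y a) 0 = y a := by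
      intro y
      rw [one_mul, neg_one_mul]
      exact max_zero_sub_eq_self _
    simp_rw [h1]
    have hi : Integrable (fun y : EuclideanSpace ℝ (Fin d) => y) ν :=
      hInt1.mono' (by fun_prop) (ae_of_all _ fun y => by linarith)
    have h2 : ∫ y, y ∂ν = 0 := by
      rw [← hν 0, integral_map (hx 0).aemeasurable (by fun_prop)]
      exact hmean
    have h3 := (EuclideanSpace.proj (𝕜 := ℝ) a).integral_comp_comm hi
    rw [h2, map_zero] at h3
    exact h3
  filter_upwards [hbound 1 (by simp), hbound (-1) (by simp)] with ω ⟨B, hB0, hB⟩ ⟨B', hB0', hB'⟩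
  refine ⟨B + B', by positivity, fun n hn => ?_⟩
  have h1 : ∑ k ∈ Finset.range n, x k ω a =
      ∑ k ∈ Finset.range n, (max (1 * x k ω a) 0 - ∫ y, max (1 * y a) 0 ∂ν)
      - ∑ k ∈ Finset.range n, (max (-1 * x k ω a) 0 - ∫ y, max (-1 * y a) 0 ∂ν) := by
    rw [← Finset.sum_sub_distrib]
    refine Finset.sum_congr rfl fun k _ => ?_
    have h2 : max (1 * x k ω a) 0 - max (-1 * x k ω a) 0 = x k ω a := by
      rw [one_mul, neg_one_mul]
      exact max_zero_sub_eq_self _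
    linarith
  rw [h1]
  refine (abs_sub _ _).trans ?_
  linarith [hB n hn, hB' n hn]

end DataProperties

/-! ### Convergence of a trajectory started from a deterministic state -/

section Convergence

variable {Ω : Type*} [MeasurableSpace Ω] {P : Measure Ω} {d : ℕ}
  {x : ℕ → Ω → EuclideanSpace ℝ (Fin d)} {w : ℕ → Ω → ℝ} {Φ φ : ℝ → ℝ} {l : ℝ}

lemma tendsto_truncBound (hl : 0 < l) : Tendsto (truncBound l) atTop atTop :=
  (tendsto_rpow_atTop (by positivity : 0 < 1 / (1 + 2 * l))).comp tendsto_natCast_atTop_atTop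

lemma traj_succ (θs : EuclideanSpace ℝ (Fin d)) {k₀ k : ℕ} (s : ℕ)
    (x : ℕ → EuclideanSpace ℝ (Fin d)) (w : ℕ → ℝ) (hk : k₀ ≤ k) :
    traj φ l θs k₀ s x w (k + 1) =
      truncStep φ l θs k (traj φ l θs k₀ s x w k, x k, w (k + 1)) := by
  simp [traj, hk]

lemma ae_sum_indicator_le [IsProbabilityMeasure P] {ν : Measure (EuclideanSpace ℝ (Fin d))}
    (hx : ∀ k, Measurable (x k)) (hν : ∀ k, P.map (x k) = ν) {c ρ : ℝ} (hc : 0 < c) (hρ0 : 0 < ρ) (hρ1 : ρ < 1)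
    (hmix : ∀ k, phiMixingCoeff P x k ≤ ENNReal.ofReal (c * ρ ^ k))
    {A : Set (EuclideanSpace ℝ (Fin d))} (hA : MeasurableSet A) :
    ∀ᵐ ω ∂P, ∃ B : ℝ, 0 ≤ B ∧ ∀ n : ℕ, 1 ≤ n →
      |∑ k ∈ Finset.range n, (A.indicator (fun _ => (1 : ℝ)) (x k ω)
        - ∫ y, A.indicator (fun _ => (1 : ℝ)) y ∂ν)| ≤ B * (n : ℝ) ^ (7 / 8 : ℝ) := by
  have hνp : IsProbabilityMeasure ν := hν 0 ▸ Measure.isProbabilityMeasure_map (hx 0).aemeasurable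
  have hm : Measurable (A.indicator fun _ => (1 : ℝ)) := measurable_const.indicator hA
  have h0 : ∀ y, 0 ≤ A.indicator (fun _ => (1 : ℝ)) y := fun y =>
    Set.indicator_nonneg (fun _ _ => zero_le_one) y
  refine ae_sum_le_rpow_of_phiMixing hx hν hc hρ0 hρ1 hmix hm h0 zero_lt_one le_rfl ?_
  refine (integrable_const 1).mono' (hm.pow_const _).aestronglyMeasurable (ae_of_all _ fun y => ?_)
  rw [Real.norm_of_nonneg (Real.rpow_nonneg (h0 y) _)]
  exact Real.rpow_le_one (h0 y) (Set.indicator_le_self' (fun _ _ => zero_le_one) y) (by norm_num)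

lemma ae_summable_rpow_mul {ν : Measure (EuclideanSpace ℝ (Fin d))} (hx : ∀ k, Measurable (x k))
    (hν : ∀ k, P.map (x k) = ν) {g : EuclideanSpace ℝ (Fin d) → ℝ} (hg0 : ∀ y, 0 ≤ g y)
    (hg : Integrable g ν) :
    ∀ᵐ ω ∂P, Summable fun k : ℕ => (k : ℝ) ^ (-(9 / 8) : ℝ) * g (x k ω) := by
  refine ae_summable_of_summable_integral
    (b := fun k : ℕ => (k : ℝ) ^ (-(9 / 8) : ℝ) * ∫ y, g y ∂ν) (fun k => ?_)
    (fun k ω => mul_nonneg (by positivity) (hg0 _)) (fun k => ?_)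
    ((Real.summable_nat_rpow.2 (by norm_num)).mul_right _)
  · rw [← hν k] at hg
    exact (hg.comp_measurable (hx k)).const_mul _
  · rw [← hν k] at hg ⊢
    rw [integral_const_mul, integral_map (hx k).aemeasurable hg.1]

lemma measure_Ioo_pos_of_density {μ : Measure ℝ} {f : ℝ → ℝ} (hf : Measurable f)
    (hμ : μ = volume.withDensity fun u => ENNReal.ofReal (f u)) (hf0 : 0 < f 0)
    (hfc : ContinuousAt f 0) {a : ℝ} (ha : 0 < a) :
    0 < μ (Set.Ioo 0 a) ∧ 0 < μ (Set.Ioo (-a) 0) := by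
  obtain ⟨η, hη, hηf⟩ := Metric.eventually_nhds_iff.1 (hfc.eventually_const_lt hf0)
  have hm : 0 < min a η := lt_min ha hη
  constructor
  · refine measure_pos_of_density_pos hf hμ (s := Set.Ioo 0 (min a η))
      (Set.Ioo_subset_Ioo le_rfl (min_le_left _ _)) (by simpa using hm) fun u hu => hηf ?_
    rw [Real.dist_eq, sub_zero, abs_of_pos hu.1]
    exact hu.2.trans_le (min_le_right _ _)
  · refine measure_pos_of_density_pos hf hμ (s := Set.Ioo (-min a η) 0)
      (Set.Ioo_subset_Ioo (neg_le_neg (min_le_left _ _)) le_rfl) (by simpa using hm)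
      fun u hu => hηf ?_
    rw [Real.dist_eq, sub_zero, abs_of_neg hu.2]
    linarith [hu.1, min_le_right a η]

/-- Decomposition of the increments into the mean drift and a noise with small partial sums. -/
lemma exists_noise_decomposition {μ : Measure ℝ} (hA : LossAssumption Φ φ l)
    (hμ : Integrable (fun s => (1 + |s|) ^ l) μ) {x θ : ℕ → EuclideanSpace ℝ (Fin d)} {w : ℕ → ℝ}
    {θs : EuclideanSpace ℝ (Fin d)} {R : ℝ}
    (hN : ∀ a : Fin d, ∃ B : ℝ, 0 ≤ B ∧ ∀ n : ℕ, 1 ≤ n → |∑ k ∈ Finset.range n,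
      centredNoise φ μ θs R ((θ k, x k), w (k + 1)) * x k a| ≤ B * (n : ℝ) ^ (7 / 8 : ℝ))
    (hx : ∀ a : Fin d, ∃ B : ℝ, 0 ≤ B ∧ ∀ n : ℕ, 1 ≤ n →
      |∑ k ∈ Finset.range n, x k a| ≤ B * (n : ℝ) ^ (7 / 8 : ℝ)) :
    ∃ S : ℕ → EuclideanSpace ℝ (Fin d),
      (∃ C : ℝ, 0 ≤ C ∧ ∀ k : ℕ, 1 ≤ k → ‖S k‖ ≤ C * (k : ℝ) ^ (7 / 8 : ℝ)) ∧
      ∀ k, ‖θ k‖ ≤ R → φ (w (k + 1) - inner ℝ (θ k - θs) (x k)) • x k =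
        meanDrift φ μ (inner ℝ (θ k - θs) (x k)) • x k + (S (k + 1) - S k) := by
  set b := ∫ t, φ t ∂μ with hb
  -- The drift is `∫ φ (s - u) - b`, so the noise must carry the constant `b` times the regressor
  -- besides the centred part; its sums are small by `hx`.
  refine ⟨fun n => ∑ k ∈ Finset.range n,
    (centredNoise φ μ θs R ((θ k, x k), w (k + 1)) + b) • x k,
    exists_norm_le_rpow_of_coord fun a => ?_, fun k hR => ?_⟩
  · obtain ⟨B₁, hB₁0, hB₁⟩ := hN a
    obtain ⟨B₂, hB₂0, hB₂⟩ := hx a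
    refine ⟨B₁ + |b| * B₂, by positivity, fun n hn => ?_⟩
    have e1 : (∑ k ∈ Finset.range n,
        (centredNoise φ μ θs R ((θ k, x k), w (k + 1)) + b) • x k) a =
        ∑ k ∈ Finset.range n, centredNoise φ μ θs R ((θ k, x k), w (k + 1)) * x k a
        + b * ∑ k ∈ Finset.range n, x k a := by
      rw [Finset.mul_sum, ← Finset.sum_add_distrib]
      simp [add_mul]
    rw [e1]
    refine (abs_add_le _ _).trans ?_
    rw [abs_mul]
    have := mul_le_mul_of_nonneg_left (hB₂ n hn) (abs_nonneg b)
    linarith [hB₁ n hn]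
  · beta_reduce
    rw [Finset.sum_range_succ, add_sub_cancel_left, ← add_smul]
    congr 1
    simp only [centredNoise]
    rw [if_pos hR, hA.meanDrift_eq hμ]
    ring

/-- Almost sure convergence of the algorithm started from a deterministic state. -/
theorem ae_tendsto_traj [IsProbabilityMeasure P] (hA1 : LossAssumption Φ φ l)
    (hA2 : RegressorAssumption P x l)
    (hA3 : NoiseAssumption P x w l) (θs : EuclideanSpace ℝ (Fin d)) {k₀ : ℕ} (hk₀ : 1 ≤ k₀)
    (s : ℕ) :
    ∀ᵐ ω ∂P, Tendsto (fun k => (traj φ l θs k₀ s (fun k => x k ω) (fun k => w k ω) k).1)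
      atTop (𝓝 θs) := by
  have hl := hA1.l_pos
  have hx := hA2.measurable
  have hw := hA3.measurable
  obtain ⟨q, hq, r, hr, hqpos⟩ := hA2.density
  obtain ⟨f, hf, -, hf0, hfc⟩ := hA3.density
  obtain ⟨c, hc, ρ, hρ0, hρ1, hmix⟩ := hA2.mixing_rate
  obtain ⟨ε, hε, hxmom⟩ := hA2.moment
  obtain ⟨ε', hε', hwmom⟩ := hA3.moment
  obtain ⟨ν, hν_def⟩ : ∃ ν : Measure (EuclideanSpace ℝ (Fin d)),
    ν = volume.withDensity fun u => ENNReal.ofReal (q u) := ⟨_, rfl⟩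
  obtain ⟨μ, hμ_def⟩ : ∃ μ : Measure ℝ,
    μ = volume.withDensity fun u => ENNReal.ofReal (f u) := ⟨_, rfl⟩
  have hν : ∀ k, P.map (x k) = ν := fun k => by rw [hν_def, (hq k).2.2]
  have hμ : ∀ k, P.map (w (k + 1)) = μ := fun k => by rw [hμ_def, (hf k).2.2]
  have hνp : IsProbabilityMeasure ν := hν 0 ▸ Measure.isProbabilityMeasure_map (hx 0).aemeasurable
  have hμp : IsProbabilityMeasure μ := hμ 0 ▸ Measure.isProbabilityMeasure_map (hw 0).aemeasurable
  -- moments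
  have hνmom : ∀ p, 0 ≤ p → p ≤ 2 * (l + 2) + ε →
      Integrable (fun y : EuclideanSpace ℝ (Fin d) => (1 + ‖y‖) ^ p) ν := fun p hp hp' =>
    integrable_one_add_rpow measurable_norm (fun y => norm_nonneg y) hp hp'
      (hν 0 ▸ (integrable_map_measure (measurable_norm.pow_const _).aestronglyMeasurable
        (hx 0).aemeasurable).2 (hxmom 0))
  have hμmom : ∀ p, 0 ≤ p → p ≤ 2 * l + ε' → Integrable (fun s : ℝ => (1 + |s|) ^ p) μ :=
    fun p hp hp' => integrable_one_add_rpow measurable_norm (fun y => norm_nonneg y) hp hp'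
      (hμ 0 ▸ (integrable_map_measure (measurable_norm.pow_const _).aestronglyMeasurable
        (hw 0).aemeasurable).2 (hwmom 0))
  have hμi : Integrable (fun s : ℝ => (1 + |s|) ^ l) μ := hμmom l hl.le (by linarith)
  have hμi2 : Integrable (fun s : ℝ => ((1 + |s|) ^ l) ^ 2) μ := by
    refine (hμmom (l * 2) (by positivity) (by linarith)).congr (ae_of_all _ fun s => ?_)
    change (1 + |s|) ^ (l * 2) = ((1 + |s|) ^ l) ^ 2
    rw [Real.rpow_mul (by positivity), Real.rpow_two]
  have hνi2 : Integrable (fun y : EuclideanSpace ℝ (Fin d) => ((1 + ‖y‖) ^ (l + 1)) ^ 2) ν := by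
    refine (hνmom ((l + 1) * 2) (by positivity) (by linarith)).congr (ae_of_all _ fun y => ?_)
    change (1 + ‖y‖) ^ ((l + 1) * 2) = ((1 + ‖y‖) ^ (l + 1)) ^ 2
    rw [Real.rpow_mul (by positivity), Real.rpow_two]
  -- With this `δ` the envelope `(1 + ‖x‖)^(l+1)` has a moment of order `2 + δ`: `(l + 1)(2 + δ) = 2
  -- l + 3`, below the assumed `2 (l + 2) + ε`.
  set δ : ℝ := 1 / (l + 1) with hδ_def
  have hδ0 : 0 < δ := by positivity
  have hδ1 : δ ≤ 1 := by rw [hδ_def, div_le_one (by positivity)]; linarith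
  have hνδ : Integrable (fun y : EuclideanSpace ℝ (Fin d) => ((1 + ‖y‖) ^ (l + 1)) ^ (2 + δ)) ν := by
    refine (hνmom ((l + 1) * (2 + δ)) (by positivity) ?_).congr (ae_of_all _ fun y => ?_)
    · rw [mul_add, hδ_def, mul_one_div_cancel (by positivity)]; linarith
    · change (1 + ‖y‖) ^ ((l + 1) * (2 + δ)) = ((1 + ‖y‖) ^ (l + 1)) ^ (2 + δ)
      rw [Real.rpow_mul (by positivity)]
  -- positivity of the densities
  have hμpos : ∀ a, 0 < a → 0 < μ (Set.Ioo 0 a) ∧ 0 < μ (Set.Ioo (-a) 0) := fun a ha =>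
    measure_Ioo_pos_of_density (hf 0).1 hμ_def hf0 hfc ha
  -- The centres lie within `r / 2` of the origin, so the balls of radius `r / 8` stay where the
  -- density is positive and are visited with positive frequency.
  obtain ⟨F, hFsub, hF, hFcover⟩ :=
    (isCompact_closedBall (0 : EuclideanSpace ℝ (Fin d)) (r / 2)).finite_cover_balls
      (show 0 < r / 8 by positivity)
  have hcover : ∀ y : EuclideanSpace ℝ (Fin d), ‖y‖ = r / 2 → ∃ p ∈ F, ‖y - p‖ < r / 8 := by
    intro y hy
    have h1 := hFcover (show y ∈ Metric.closedBall 0 (r / 2) by simp [hy])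
    simp only [Set.mem_iUnion, mem_ball_iff_norm, exists_prop] at h1
    exact h1
  have hball : ∀ p ∈ F, 0 < ν.real (Metric.ball p (r / 8)) := by
    intro p hp
    have h1 : 0 < ν (Metric.ball p (r / 8)) := by
      refine measure_pos_of_density_pos (hq 0).1 hν_def subset_rfl
        (Metric.measure_ball_pos _ _ (by positivity)) fun u hu => hqpos u ?_
      have h2 := hFsub hp
      rw [mem_closedBall_zero_iff] at h2
      rw [mem_ball_iff_norm] at hu
      rw [mem_ball_zero_iff]
      have h3 := norm_add_le (u - p) p
      rw [sub_add_cancel] at h3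
      linarith
    exact ENNReal.toReal_pos h1.ne' (measure_ne_top _ _)
  -- almost sure properties of the data
  have ae_noise : ∀ᵐ ω ∂P, ∀ (R : ℕ) (a : Fin d), ∃ B : ℝ, 0 ≤ B ∧ ∀ n : ℕ, 1 ≤ n →
      |∑ k ∈ Finset.range n, centredNoise φ μ θs R
        (((traj φ l θs k₀ s (fun k => x k ω) (fun k => w k ω) k).1, x k ω), w (k + 1) ω)
        * x k ω a| ≤ B * (n : ℝ) ^ (7 / 8 : ℝ) :=
    ae_all_iff.2 fun R => ae_all_iff.2 fun a =>
      ae_sum_centredNoise_le hA1 hx hw hν hμ hνi2 hμi2 hμi hA3.indep_past θs k₀ s R a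
  have ae_reg : ∀ᵐ ω ∂P, ∀ a : Fin d, ∃ B : ℝ, 0 ≤ B ∧ ∀ n : ℕ, 1 ≤ n →
      |∑ k ∈ Finset.range n, x k ω a| ≤ B * (n : ℝ) ^ (7 / 8 : ℝ) :=
    ae_all_iff.2 fun a => ae_sum_regressor_le hx hν hc hρ0 hρ1 hδ0 hδ1 hmix
      (hνmom _ (by positivity) (by linarith)) (hA2.mean_zero 0) a
  have ae_env := ae_sum_le_rpow_of_phiMixing hx hν hc hρ0 hρ1 hmix
    (f := fun y => (1 + ‖y‖) ^ (l + 1)) (by fun_prop) (fun y => by positivity) hδ0 hδ1 hνδ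
  have ae_ball := (ae_ball_iff hF.countable).2 fun p _ => ae_sum_indicator_le hx hν hc hρ0 hρ1 hmix
    (A := Metric.ball p (r / 8)) measurableSet_ball
  have ae_sum := ae_summable_rpow_mul hx hν
    (g := fun y => ((1 + ‖y‖) ^ (l + 1)) ^ 2) (fun y => sq_nonneg _) hνi2
  filter_upwards [ae_noise, ae_reg, ae_env, ae_ball, ae_sum] with ω h1 h2 ⟨B, _, hB⟩ h4 h5
  have hT : ∀ k, k₀ ≤ k → _ := fun k hk =>
    traj_succ (φ := φ) (l := l) θs s (fun k => x k ω) (fun k => w k ω) hk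
  generalize traj φ l θs k₀ s (fun k => x k ω) (fun k => w k ω) = T at h1 hT ⊢
  have hdrift : ∀ R : ℝ, 0 ≤ R → ∃ C, 0 ≤ C ∧ ∀ k (v : EuclideanSpace ℝ (Fin d)), ‖v‖ ≤ R →
      |meanDrift φ μ (inner ℝ v (x k ω))| * ‖x k ω‖ ≤ C * (1 + ‖x k ω‖) ^ (l + 1) := by
    intro R hR
    obtain ⟨C, hC, hCb⟩ := hA1.exists_abs_meanDrift_le hμi
    refine ⟨C * (1 + R) ^ l, by positivity, fun k v hv => ?_⟩
    calc |meanDrift φ μ (inner ℝ v (x k ω))| * ‖x k ω‖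
        ≤ C * (1 + |inner ℝ v (x k ω)|) ^ l * ‖x k ω‖ := by gcongr; exact hCb _
      _ = C * ((1 + |inner ℝ v (x k ω)|) ^ l * ‖x k ω‖) := by ring
      _ ≤ C * ((1 + R) ^ l * (1 + ‖x k ω‖) ^ (l + 1)) := by
          gcongr C * ?_
          exact rpow_one_add_abs_inner_mul_le hl.le hR hv
      _ = _ := by ring
  have hnoise : ∀ R : ℕ, ∃ S : ℕ → EuclideanSpace ℝ (Fin d),
      (∃ C : ℝ, 0 ≤ C ∧ ∀ k : ℕ, 1 ≤ k → ‖S k‖ ≤ C * (k : ℝ) ^ (7 / 8 : ℝ)) ∧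
      ∀ k, k₀ ≤ k → ‖(T k).1‖ ≤ R → φ (w (k + 1) ω - inner ℝ ((T k).1 - θs) (x k ω)) • x k ω =
        meanDrift φ μ (inner ℝ ((T k).1 - θs) (x k ω)) • x k ω + (S (k + 1) - S k) := by
    intro R
    obtain ⟨S, hS, hSz⟩ := exists_noise_decomposition hA1 hμi (θ := fun k => (T k).1)
      (x := fun k => x k ω) (w := fun k => w k ω) (h1 R) h2
    exact ⟨S, hS, fun k _ hR => hSz k hR⟩
  have hfreq : ∀ p ∈ F, ∃ π, 0 < π ∧ Tendsto (fun n : ℕ => (∑ k ∈ Finset.range n,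
      (Metric.ball p (r / 8)).indicator (fun _ => (1 : ℝ)) (x k ω)) / n) atTop (𝓝 π) := by
    intro p hp
    obtain ⟨B', -, hB'⟩ := h4 p hp
    refine ⟨_, ?_, tendsto_average_of_sum_le_rpow hB'⟩
    rw [integral_indicator_const _ measurableSet_ball, smul_eq_mul, mul_one]
    exact hball p hp
  have hone : ∀ k, 1 ≤ (1 + ‖x k ω‖) ^ (l + 1) := fun k =>
    Real.one_le_rpow (by linarith [norm_nonneg (x k ω)]) (by positivity)
  exact tendsto_of_expanding_truncations (θ := fun k => (T k).1) (σ := fun k => (T k).2)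
    (x := fun k => x k ω) (M := truncBound l) (h := meanDrift φ μ)
    (z := fun k => φ (w (k + 1) ω - inner ℝ ((T k).1 - θs) (x k ω)) • x k ω)
    (e := fun k => (1 + ‖x k ω‖) ^ (l + 1)) hk₀ (tendsto_truncBound hl)
    (fun k hk => by rw [hT k hk, truncStep]) (fun k hk => by rw [hT k hk, truncStep])
    hone hdrift hnoise h5 (hA1.mul_meanDrift_nonpos hμi)
    (fun a ha => hA1.exists_mul_meanDrift_le hμi hμpos ha)
    (tendsto_average_of_sum_le_rpow hB) hr hF hcover hfreq

end Convergence

end ConvexIdent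

/-! ### Reduction of the algorithm to trajectories with deterministic start -/

open ConvexIdent in
/-- A generated sequence that is in the state `(0, s)` at time `k₀` coincides from then on with
the trajectory started there. -/
lemma ConvexIdent.IsGenerated.eq_traj {d : ℕ} {φ : ℝ → ℝ} {l : ℝ}
    {x θ : ℕ → EuclideanSpace ℝ (Fin d)} {y w : ℕ → ℝ} {σ : ℕ → ℕ}
    {θs : EuclideanSpace ℝ (Fin d)} (hgen : IsGenerated φ l x y θ σ)
    (hsys : ∀ k, y (k + 1) = inner ℝ θs (x k) + w (k + 1)) {k₀ s : ℕ} (hk₀ : 2 ≤ k₀)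
    (hθ : θ k₀ = 0) (hσ : σ k₀ = s) {k : ℕ} (hk : k₀ ≤ k) :
    traj φ l θs k₀ s x w k = (θ k, σ k) := by
  induction k, hk using Nat.le_induction with
  | base =>
    obtain ⟨j, rfl⟩ : ∃ j, k₀ = j + 1 := ⟨k₀ - 1, by omega⟩
    simp [traj, hθ, hσ]
  | succ k hk ih =>
    have hc : θ k + (1 / (k : ℝ)) • φ (w (k + 1) - inner ℝ (θ k - θs) (x k)) • x k =
        candidate φ x y θ k := by
      rw [candidate, smul_smul, hsys k, inner_sub_left]
      congr 4
      ring
    have hσk : σ (k + 1) =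
        σ k + if truncBound l (σ k) < ‖candidate φ x y θ k‖ then 1 else 0 := by
      -- The counter satisfies a one-step recursion only from time 2 on, because `σ 1 = 1` is not
      -- the empty sum; hence `2 ≤ k₀`.
      obtain ⟨j, rfl⟩ : ∃ j, k = j + 1 := ⟨k - 1, by omega⟩
      rw [hgen.sigma_succ (j + 1) (by omega), Finset.sum_Icc_succ_top (by omega),
        ← hgen.sigma_succ j (by omega)]
    rw [traj_succ θs s _ _ hk, ih, hgen.theta_succ k (by omega), hσk]
    simp only [truncStep, hc]

theorem theorem3 {Ω : Type*} [MeasurableSpace Ω] (P : Measure Ω) [IsProbabilityMeasure P]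
    {d : ℕ} (Φ φ : ℝ → ℝ) (l : ℝ)
    (x : ℕ → Ω → EuclideanSpace ℝ (Fin d)) (w y : ℕ → Ω → ℝ)
    (θstar : EuclideanSpace ℝ (Fin d))
    (hsys : ∀ k ω, y (k + 1) ω = inner ℝ θstar (x k ω) + w (k + 1) ω)
    (hA1 : ConvexIdent.LossAssumption Φ φ l)
    (hA2 : ConvexIdent.RegressorAssumption P x l)
    (hA3 : ConvexIdent.NoiseAssumption P x w l)
    (θ : ℕ → Ω → EuclideanSpace ℝ (Fin d)) (σ : ℕ → Ω → ℕ)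
    (hgen : ∀ ω, ConvexIdent.IsGenerated φ l (fun k => x k ω) (fun k => y k ω)
      (fun k => θ k ω) (fun k => σ k ω)) :
    ∀ᵐ ω ∂P, Tendsto (fun k => θ k ω) atTop (𝓝 θstar) := by
  -- The reset time and the counter value are random, but range over a countable set, so one null
  -- set serves all of them and no measurability of `θ` is needed.
  have hconv : ∀ᵐ ω ∂P, ∀ k₀ s : ℕ, 1 ≤ k₀ → Tendsto (fun k => (ConvexIdent.traj φ l θstar k₀ s
      (fun k => x k ω) (fun k => w k ω) k).1) atTop (𝓝 θstar) :=
    ae_all_iff.2 fun k₀ => ae_all_iff.2 fun s => by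
      by_cases hk₀ : 1 ≤ k₀
      · filter_upwards [ConvexIdent.ae_tendsto_traj hA1 hA2 hA3 θstar hk₀ s] with ω hω _ using hω
      · exact ae_of_all _ fun ω h => absurd h hk₀
  filter_upwards [hconv] with ω hω
  -- by time 3 the estimate has been reset to the origin, whatever the initial value
  have hreset : ∃ k₀, 2 ≤ k₀ ∧ θ k₀ ω = 0 := by
    have hθ2 := (hgen ω).theta_succ 1 le_rfl
    have hθ3 := (hgen ω).theta_succ 2 (by norm_num)
    have hσ2 := (hgen ω).sigma_succ 1 le_rfl
    simp only [Finset.Icc_self, Finset.sum_singleton] at hσ2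
    split_ifs at hθ2 with h1
    · rw [if_neg (not_lt.2 h1)] at hσ2
      refine ⟨3, by norm_num, ?_⟩
      rw [hσ2] at hθ3
      split_ifs at hθ3 with h2
      · have h0 : ConvexIdent.truncBound l 0 = 0 := by
          have := hA1.l_pos
          rw [ConvexIdent.truncBound, Nat.cast_zero, Real.zero_rpow (by positivity)]
        rw [h0, norm_le_zero_iff] at h2
        exact hθ3.trans h2
      · exact hθ3
    · exact ⟨2, le_rfl, hθ2⟩
  obtain ⟨k₀, hk₀, hθ0⟩ := hreset
  refine (hω k₀ (σ k₀ ω) (by omega)).congr' ?_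
  filter_upwards [eventually_ge_atTop k₀] with k hk
  rw [(hgen ω).eq_traj (fun k => hsys k ω) hk₀ hθ0 rfl hk]
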